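/- Let $E$ be a countable set, $\mathcal H_0=\ell^2(E)$ (complex), with basis $(e_x)_{x\in E}$, and let $A$ be a bounded positive operator on $\mathcal H_0$ with $\ker A=\{0\}$. Let $\mathcal H_-$ be the completion of $\mathcal H_0$ for $(f,g)_-=(f,Ag)_0$ and $\mathcal H_+$ the completion of $\operatorname{Ran}A$ for $(f,g)_+=(f,A^{-1}g)_0$; $\mathcal H_+$ consists of functions on $E$, with reproducing kernel $A(x,y)$. Assume (H): $\mathcal H_-$ is functionally completed, i.e. the inclusion of $\mathcal H_0$ in the functions on $E$ extends to an injective linear map on $\mathcal H_-$ for which every point evaluation is continuous. Let $\mathcal X$ be the set of subsets of $E$, identified with $\{0,1\}^E$, write $x\xi=\{x\}\cup\xi$, and let $\mu$ be the determinantal point process with kernel operator $K=A(I+A)^{-1}$, i.e. the probability measure on $\mathcal X$ with $\mu(\xi\supset S)=\det(K(x,y))_{x,y\in S}$ for all finite $S\subset E$. For $x\notin\xi$ let $\alpha(x;\xi)=\lim_{\Lambda\uparrow E}\mu(\zeta_\Lambda=(x\xi)_\Lambda)/\mu(\zeta_\Lambda=\xi_\Lambda)$ (limit over finite $\Lambda\subset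 E$; $\zeta_\Lambda=\zeta\cap\Lambda$) be the Papangelou intensity. Then this limit exists and is positive for all $x\notin\xi\in\mathcal X$; put $\beta(x;\xi)=1/\alpha(x;\xi)$. Let $D(\mathcal X)$ be the set of continuous $f:\mathcal X\to\mathbb R$ with $\sum_x\sup_\xi|f(x\xi)-f(\xi)|<\infty$. Detailed balance of an operator $L$ with respect to $\mu$ means: for all $f,g\in D(\mathcal X)$, $f\,Lg$ and $(Lf)\,g$ are $\mu$-integrable and $\int f\,Lg\,d\mu=\int (Lf)\,g\,d\mu$. (a) Glauber dynamics. For $x\notin\xi$ put $b(x;\xi)=\frac{\alpha(x;\xi)}{1+\alpha(x;\xi)}$ and $d(x;x\xi)=\frac{\beta(x;\xi)}{1+\beta(x;\xi)}$. These rates are nonnegative and uniformly bounded, $\sup_x\sup_{\xi\not\ni x}\max\{b(x;\xi),d(x;x\xi)\}<\infty$; they satisfy $b(x;\xi)=\alpha(x;\xi)d(x;x\xi)$; the series in $$L^{(G)}f(\xi)=\sum_{x\in\xi}d(x;\xi)[f(\xi\setminus x)-f(\xi)]+\sum_{y\notin\xi}b(y;\xi)[f(y\xi)-f(\xi)]$$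 converge absolutely for $f\in D(\mathcal X)$, and $L^{(G)}$ satisfies detailed balance with respect to $\mu$. (a') Let $\hat\beta(x;\xi)=\lim_{\Lambda\uparrow E}\inf\|e_x-g\|_+^2$, the infimum over $g$ in the span of $\{e_y:y\in\Lambda\setminus x\xi\}$. With $d(x;x\xi)=\hat\beta(x;\xi)/(1+\hat\beta(x;\xi))$ in place of the above and the same $b$, the rates are again nonnegative and uniformly bounded and the series converge absolutely, and detailed balance holds if and only if for $\mu$-almost every $\xi$ one has $\alpha(x;\xi)\hat\beta(x;\xi)=1$ for all $x\notin\xi$. (b) Kawasaki dynamics. Let $d:E\times E\to[0,\infty)$ be symmetric and let $g:(0,\infty)^2\to[0,\infty)$ be symmetric and continuous. For $x\ne y$, $x,y\notin\xi$, put $c(x,y;x\xi)=d(x,y)\,\alpha(y;\xi)\,g(\alpha(x;\xi),\alpha(y;\xi))$, and let $c(x,y;\xi)=0$ unless $x\in\xi$, $y\notin\xi$. Then $c\ge0$ and $\alpha(x;\xi)c(x,y;x\xi)=\alpha(y;\xi)c(y,x;y\xi)$. Put $c^{(K)}=\sup_x\sum_{y\ne x}\sup_{\xi\not\ni x,y}\max\{c(x,y;x\xi),c(y,x;y\xi)\}$.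 If $g$ extends continuously to $[0,\infty)^2$ and $\sup_x\sum_{y\neq x}d(x,y)<\infty$, then $c^{(K)}<\infty$. Whenever $c^{(K)}<\infty$, the rates $c(x,y;\xi)$ are uniformly bounded, the series in $$L^{(K)}f(\xi)=\sum_{x\in\xi,\,y\notin\xi}c(x,y;\xi)[f(y\xi\setminus x)-f(\xi)]$$ converges absolutely for $f\in D(\mathcal X)$, and $L^{(K)}$ satisfies detailed balance with respect to $\mu$. -/

import Mathlib

open MeasureTheory Filter Topology
open scoped ENNReal lp

namespace DPPDynamics

noncomputable section

variable {E : Type*}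

/-! ### The Hilbert space of square summable functions and the dual pair of spaces -/

/-- `l²(E)` with complex values; its inner product is conjugate linear in the first entry. -/
abbrev H0 (E : Type*) := ℓ²(E, ℂ)

open Classical in
/-- The basis vector `e_x`. -/
def basisVec (x : E) : H0 E := lp.single 2 x 1

/-- The matrix element `T(x, y) = (e_x, T e_y)₀`. -/
def kernel (T : H0 E →L[ℂ] H0 E) (x y : E) : ℂ := inner ℂ (basisVec x) (T (basisVec y))

/-- `H₀`, to be equipped with the inner product `(f, g)₋ = (f, A g)₀`. -/
def PreMinus (A : H0 E →L[ℂ] H0 E) (_hA : A.IsPositive) : Type _ := H0 E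

instance (A : H0 E →L[ℂ] H0 E) (hA : A.IsPositive) : AddCommGroup (PreMinus A hA) :=
  inferInstanceAs (AddCommGroup (H0 E))

instance (A : H0 E →L[ℂ] H0 E) (hA : A.IsPositive) : Module ℂ (PreMinus A hA) :=
  inferInstanceAs (Module ℂ (H0 E))

/-- The identity map from `H₀` to its copy with the inner product `(·,·)₋`. -/
def toPreMinus (A : H0 E →L[ℂ] H0 E) (hA : A.IsPositive) : H0 E ≃ₗ[ℂ] PreMinus A hA :=
  LinearEquiv.refl ℂ (H0 E)

/-- `(f, g)₋ = (f, A g)₀`. -/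
@[reducible]
def minusCore (A : H0 E →L[ℂ] H0 E) (hA : A.IsPositive) :
    PreInnerProductSpace.Core ℂ (PreMinus A hA) where
  inner f g := inner ℂ ((toPreMinus A hA).symm f) (A ((toPreMinus A hA).symm g))
  conj_inner_symm f g := by
    rw [inner_conj_symm]
    exact hA.isSymmetric _ _
  re_inner_nonneg f := hA.re_inner_nonneg_right _
  add_left f g h := by rw [map_add, inner_add_left]
  smul_left f g r := by rw [map_smul, inner_smul_left]

instance (A : H0 E →L[ℂ] H0 E) (hA : A.IsPositive) : SeminormedAddCommGroup (PreMinus A hA) :=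
  @InnerProductSpace.Core.toSeminormedAddCommGroup ℂ (PreMinus A hA) _ _ _ (minusCore A hA)

instance (A : H0 E →L[ℂ] H0 E) (hA : A.IsPositive) : InnerProductSpace ℂ (PreMinus A hA) :=
  InnerProductSpace.ofCore (minusCore A hA)

/-- The Hilbert space `H₋`, the completion of `H₀` for `‖·‖₋`. -/
abbrev HMinus (A : H0 E →L[ℂ] H0 E) (hA : A.IsPositive) : Type _ :=
  UniformSpace.Completion (PreMinus A hA)

/-- Hypothesis (H): `H₋` is functionally completed. Its vectors are represented, linearly and
faithfully, by functions on `E`, the elements of `H₀` by themselves, and the value at each point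
depends continuously on the vector (functional completion in the sense of Aronszajn). -/
def HypothesisH (A : H0 E →L[ℂ] H0 E) (hA : A.IsPositive) : Prop :=
  ∃ J : HMinus A hA →ₗ[ℂ] (E → ℂ),
    Function.Injective J ∧
    (∀ x, Continuous fun v => J v x) ∧
    ∀ (f : H0 E) (x : E), J (toPreMinus A hA f : HMinus A hA) x = f x

/-- `Ran A`, to be equipped with the inner product `(f, g)₊ = (f, A⁻¹ g)₀`. -/
def PrePlus (A : H0 E →L[ℂ] H0 E) (_hA : A.IsPositive)
    (_hker : LinearMap.ker (A : H0 E →ₗ[ℂ] H0 E) = ⊥) : Type _ :=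
  LinearMap.range (A : H0 E →ₗ[ℂ] H0 E)

section Plus

variable (A : H0 E →L[ℂ] H0 E) (hA : A.IsPositive)
  (hker : LinearMap.ker (A : H0 E →ₗ[ℂ] H0 E) = ⊥)

instance : AddCommGroup (PrePlus A hA hker) :=
  inferInstanceAs (AddCommGroup (LinearMap.range (A : H0 E →ₗ[ℂ] H0 E)))

instance : Module ℂ (PrePlus A hA hker) :=
  inferInstanceAs (Module ℂ (LinearMap.range (A : H0 E →ₗ[ℂ] H0 E)))

/-- The operator `A` as a bijection of `H₀` onto its range. -/
def toPrePlus : H0 E ≃ₗ[ℂ] PrePlus A hA hker :=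
  LinearEquiv.ofInjective (A : H0 E →ₗ[ℂ] H0 E) (LinearMap.ker_eq_bot.mp hker)

/-- The inclusion of `Ran A` in `H₀`. -/
def prePlusVal : PrePlus A hA hker →ₗ[ℂ] H0 E :=
  (LinearMap.range (A : H0 E →ₗ[ℂ] H0 E)).subtype

theorem prePlusVal_eq (f : PrePlus A hA hker) :
    prePlusVal A hA hker f = A ((toPrePlus A hA hker).symm f) := by
  obtain ⟨h, rfl⟩ := (toPrePlus A hA hker).surjective f
  rw [LinearEquiv.symm_apply_apply]
  rfl

/-- `(f, g)₊ = (f, A⁻¹ g)₀`. -/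
@[reducible]
def plusCore : PreInnerProductSpace.Core ℂ (PrePlus A hA hker) where
  inner f g := inner ℂ (prePlusVal A hA hker f) ((toPrePlus A hA hker).symm g)
  conj_inner_symm f g := by
    rw [inner_conj_symm, prePlusVal_eq, prePlusVal_eq]
    exact (hA.isSymmetric _ _).symm
  re_inner_nonneg f := by
    rw [prePlusVal_eq]
    exact hA.re_inner_nonneg_left _
  add_left f g h := by rw [map_add, inner_add_left]
  smul_left f g r := by rw [map_smul, inner_smul_left]

instance : SeminormedAddCommGroup (PrePlus A hA hker) :=
  @InnerProductSpace.Core.toSeminormedAddCommGroup ℂ (PrePlus A hA hker) _ _ _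
    (plusCore A hA hker)

instance : InnerProductSpace ℂ (PrePlus A hA hker) :=
  InnerProductSpace.ofCore (plusCore A hA hker)

/-- The Hilbert space `H₊`, the completion of `Ran A` for `‖·‖₊`. -/
abbrev HPlus : Type _ := UniformSpace.Completion (PrePlus A hA hker)

/-- A vector of `H₊` as a function on `E`, through the reproducing kernel `A(·, x) = A e_x`:
`v(x) = (A e_x, v)₊`. -/
def plusFun (v : HPlus A hA hker) (x : E) : ℂ :=
  inner ℂ ((toPrePlus A hA hker (basisVec x) : PrePlus A hA hker) : HPlus A hA hker) v

/-- On `Ran A` this is the original function. -/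
theorem plusFun_coe (f : PrePlus A hA hker) (x : E) :
    plusFun A hA hker (f : HPlus A hA hker) x = prePlusVal A hA hker f x := by
  unfold plusFun
  rw [UniformSpace.Completion.inner_coe]
  change inner ℂ (A (basisVec x)) ((toPrePlus A hA hker).symm f) = _
  rw [prePlusVal_eq]
  refine (hA.isSymmetric _ _).trans ?_
  simp [basisVec, lp.inner_single_left]

open Classical in
/-- The linear space spanned by the functions `e_y`, `y ∈ R`. -/
def locSpan (R : Set E) : Submodule ℂ (E → ℂ) :=
  Submodule.span ℂ ((fun y => (Pi.single y (1 : ℂ) : E → ℂ)) '' R)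

open Classical in
/-- `inf ‖e_x - g‖₊²` over `g` in the span of the `e_y` with `y ∈ Λ` outside `ξ ∪ {x}`. -/
def localDualIntensity (Λ : Finset E) (x : E) (ξ : Set E) : ℝ :=
  sInf {r : ℝ | ∃ v : HPlus A hA hker, ∃ g ∈ locSpan ((Λ : Set E) \ insert x ξ),
    plusFun A hA hker v = Pi.single x 1 - g ∧ r = ‖v‖ ^ 2}

/-- The dual variational quantity: the limit of `localDualIntensity` as `Λ ↑ E`. -/
def dualIntensity (x : E) (ξ : Set E) : ℝ :=
  limUnder atTop fun Λ : Finset E => localDualIntensity A hA hker Λ x ξ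

end Plus

/-! ### Point processes. A configuration is a subset of `E`; the σ-algebra on `Set E` is the
product one. -/

open Classical in
/-- `μ` is the determinantal point process with kernel operator `K`. -/
def IsDPP (K : H0 E →L[ℂ] H0 E) (μ : Measure (Set E)) : Prop :=
  ∀ S : Finset E, ((μ.real {ξ : Set E | (S : Set E) ⊆ ξ} : ℝ) : ℂ) =
    (Matrix.of fun x y : S => kernel K (x : E) (y : E)).det

/-- The operator `K = A (I + A)⁻¹`. -/
def dppOperator (A : H0 E →L[ℂ] H0 E) : H0 E →L[ℂ] H0 E := A * Ring.inverse (1 + A)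

/-- The local marginal `μ_Λ(ξ_Λ) = μ {ζ : ζ_Λ = ξ_Λ}`. -/
def marginal (μ : Measure (Set E)) (Λ : Finset E) (ξ : Set E) : ℝ :=
  μ.real {ζ : Set E | ζ ∩ (Λ : Set E) = ξ ∩ (Λ : Set E)}

/-- The local Papangelou intensity `μ_Λ(x ξ_Λ) / μ_Λ(ξ_Λ)`, meant for `x ∈ Λ`, `x ∉ ξ`. -/
def localPapangelou (μ : Measure (Set E)) (Λ : Finset E) (x : E) (ξ : Set E) : ℝ :=
  marginal μ Λ (insert x ξ) / marginal μ Λ ξ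

/-- The Papangelou intensity `α(x; ξ)`, the limit of the local ones as `Λ ↑ E`. -/
def papangelou (μ : Measure (Set E)) (x : E) (ξ : Set E) : ℝ :=
  limUnder atTop fun Λ : Finset E => localPapangelou μ Λ x ξ

/-! ### Lattice gas dynamics -/

/-- Continuity on the configuration space, identified with `{0,1}^E`. -/
def ConfigContinuous (f : Set E → ℝ) : Prop :=
  Continuous fun η : E → Bool => f {x | η x = true}

/-- The class `D(𝒳)`: continuous `f` with `∑ₓ sup_ξ |f(xξ) - f(ξ)| < ∞`. -/
def IsSmooth (f : Set E → ℝ) : Prop :=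
  ConfigContinuous f ∧
    ∑' x : E, ⨆ ξ : Set E, ENNReal.ofReal |f (insert x ξ) - f ξ| < ∞

/-- The pregenerator of Glauber dynamics with birth rates `b` and death rates `d`. -/
def glauberGenerator (b d : E → Set E → ℝ) (f : Set E → ℝ) (ξ : Set E) : ℝ :=
  ∑' x : ξ, d x ξ * (f (ξ \ {(x : E)}) - f ξ) +
    ∑' y : (ξᶜ : Set E), b y ξ * (f (insert (y : E) ξ) - f ξ)

/-- The series defining the Glauber pregenerator converge absolutely on `D(𝒳)`. -/
def GlauberConverges (b d : E → Set E → ℝ) : Prop :=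
  ∀ f, IsSmooth f → ∀ ξ : Set E,
    (Summable fun x : ξ => d x ξ * (f (ξ \ {(x : E)}) - f ξ)) ∧
    Summable fun y : (ξᶜ : Set E) => b y ξ * (f (insert (y : E) ξ) - f ξ)

/-- The pregenerator of Kawasaki dynamics with jump rates `c`. -/
def kawasakiGenerator (c : E → E → Set E → ℝ) (f : Set E → ℝ) (ξ : Set E) : ℝ :=
  ∑' p : ξ × (ξᶜ : Set E),
    c p.1 p.2 ξ * (f (insert (p.2 : E) (ξ \ {(p.1 : E)})) - f ξ)

/-- The series defining the Kawasaki pregenerator converges absolutely on `D(𝒳)`. -/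
def KawasakiConverges (c : E → E → Set E → ℝ) : Prop :=
  ∀ f, IsSmooth f → ∀ ξ : Set E, Summable fun p : ξ × (ξᶜ : Set E) =>
    c p.1 p.2 ξ * (f (insert (p.2 : E) (ξ \ {(p.1 : E)})) - f ξ)

/-- `c^(G) = sup_x sup_{ξ ∌ x} max {b(x; ξ), d(x; xξ)}`. -/
def glauberBound (b d : E → Set E → ℝ) : ℝ≥0∞ :=
  ⨆ (x : E) (ξ : Set E) (_ : x ∉ ξ),
    max (ENNReal.ofReal (b x ξ)) (ENNReal.ofReal (d x (insert x ξ)))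

/-- `c_{x,y} = sup_{ξ ∌ x,y} max {c(x, y; xξ), c(y, x; yξ)}`. -/
def kawasakiPairBound (c : E → E → Set E → ℝ) (x y : E) : ℝ≥0∞ :=
  ⨆ (ξ : Set E) (_ : x ∉ ξ ∧ y ∉ ξ),
    max (ENNReal.ofReal (c x y (insert x ξ))) (ENNReal.ofReal (c y x (insert y ξ)))

/-- `c^(K) = sup_x ∑_{y ≠ x} c_{x,y}`. -/
def kawasakiBound (c : E → E → Set E → ℝ) : ℝ≥0∞ :=
  ⨆ x : E, ∑' y : {y : E // y ≠ x}, kawasakiPairBound c x y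

/-- Detailed balance with respect to `μ`: the pregenerator `L` is symmetric on `D(𝒳)`. -/
def DetailedBalance (μ : Measure (Set E)) (L : (Set E → ℝ) → Set E → ℝ) : Prop :=
  ∀ f g, IsSmooth f → IsSmooth g →
    Integrable (fun ξ => f ξ * L g ξ) μ ∧ Integrable (fun ξ => L f ξ * g ξ) μ ∧
      ∫ ξ, f ξ * L g ξ ∂μ = ∫ ξ, L f ξ * g ξ ∂μ

/-! ### The rates -/

open Classical in
/-- The birth rate `b(x; ξ) = α(x; ξ) / (1 + α(x; ξ))` for `x ∉ ξ`, and zero for `x ∈ ξ`. -/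
def birthRate (α : E → Set E → ℝ) (x : E) (ξ : Set E) : ℝ :=
  if x ∈ ξ then 0 else α x ξ / (1 + α x ξ)

open Classical in
/-- The death rate with `d(x; xξ) = β(x; ξ) / (1 + β(x; ξ))` for `x ∉ ξ`, and zero at a site
that is not occupied. -/
def deathRate (β : E → Set E → ℝ) (x : E) (ξ : Set E) : ℝ :=
  if x ∈ ξ then β x (ξ \ {x}) / (1 + β x (ξ \ {x})) else 0

open Classical in
/-- The jump rate with `c(x, y; xξ) = w(x, y) α(y; ξ) g(α(x; ξ), α(y; ξ))` for `x, y ∉ ξ`,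
`x ≠ y`, and zero unless the first site is occupied and the second one is empty. -/
def jumpRate (α : E → Set E → ℝ) (w : E → E → ℝ) (g : ℝ → ℝ → ℝ) (x y : E) (ξ : Set E) : ℝ :=
  if x ∈ ξ ∧ y ∉ ξ then
    w x y * α y (ξ \ {x}) * g (α x (ξ \ {x})) (α y (ξ \ {x}))
  else 0

end

end DPPDynamics

open DPPDynamics

/-! The core is a variational formula. Since K = A(I+A)⁻¹ and I - K = (I+A)⁻¹, Cramer's rule shows
that the quotient of the determinants for μ_Λ(xξ_Λ) and μ_Λ(ξ_Λ) is the minimum of (u, Au) + ‖u‖² on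
Λᶜ, over u with u(x) = 1 that vanish on Λ \ xξ (`localPapangelou_isLeast`). As Λ grows these minima
tend to the infimum of (u, Au) over u supported on xξ with u(x) = 1 (`tendsto_localPapangelou`). The
upper bound only needs that tails vanish; the lower bound uses a penalty independent of Λ and the
parallelogram law. Testing with e_x bounds all intensities by ‖A‖. Hypothesis (H) bounds |u(x)|² by
a multiple of (u, Au), so the limit is positive (`papangelouInf_pos`).

In a finite window the definition of the local intensity is already the Georgii–Nguyen–Zessin (GNZ)
equation. Dominated convergence and a π-system argument carry it over to α (`setIntegral_mem_eq`).

Both dynamics are then treated term by term. For Glauber dynamics, GNZ turns the contribution of the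
site x to ∫ (f Lg - g Lf) dμ into the integral over x ∉ ξ of (α d - b)(f(xξ)g(ξ) - g(xξ)f(ξ)). Hence
α d = b is sufficient, and indicator functions that isolate a single site show that it is necessary
almost surely (`glauber_detailedBalance_iff`). For the rates at hand, α d = b says that the two
intensities are reciprocal, which gives both (a) and (a'). For Kawasaki dynamics the contribution of
the pair (x, y) changes sign when x and y are exchanged, so the sum over all pairs vanishes
(`kawasaki_detailedBalance`). -/

namespace DPPDynamics

noncomputable section

variable {E : Type*}

section

/-! ### Coordinates and cut-offs in `l²(E)` -/

theorem inner_basisVec (x : E) (f : H0 E) : inner ℂ (basisVec x) f = f x := by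
  simp [basisVec, lp.inner_single_left]

theorem kernel_eq (T : H0 E →L[ℂ] H0 E) (x y : E) : kernel T x y = T (basisVec y) x :=
  inner_basisVec _ _

open Classical in
theorem basisVec_apply (x y : E) : (basisVec x : H0 E) y = if y = x then 1 else 0 := by
  simp [basisVec, Pi.single_apply]

theorem norm_basisVec (x : E) : ‖(basisVec x : H0 E)‖ = 1 := by
  simp [basisVec, lp.norm_single]

theorem hasSum_norm_sq (f : H0 E) : HasSum (fun i => ‖f i‖ ^ 2) (‖f‖ ^ 2) := by
  simpa using lp.hasSum_norm (p := 2) (by norm_num) f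

open Classical in
/-- Multiplication by the indicator function of `R`. -/
def cut (R : Set E) : H0 E →L[ℂ] H0 E :=
  LinearMap.mkContinuous
    { toFun := fun f => ⟨fun y => if y ∈ R then f y else 0,
        (lp.memℓp f).mono' fun i => by split_ifs <;> simp⟩
      map_add' := fun f g => by
        ext i
        change (if i ∈ R then f i + g i else 0) =
          (if i ∈ R then f i else 0) + if i ∈ R then g i else 0
        split_ifs <;> simp
      map_smul' := fun c f => by ext i; by_cases h : i ∈ R <;> simp [h] }
    1 fun f => by
      rw [one_mul]
      exact lp.norm_mono (by norm_num) fun i => by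
        by_cases h : i ∈ R <;> simp [h]

open Classical in
theorem cut_apply (R : Set E) (f : H0 E) (y : E) : cut R f y = if y ∈ R then f y else 0 := rfl

theorem cut_isPositive (R : Set E) : (cut R).IsPositive := by
  rw [ContinuousLinearMap.isPositive_iff]
  refine ⟨fun f g => ?_, fun f => ?_⟩
  · simp only [ContinuousLinearMap.coe_coe, lp.inner_eq_tsum]
    refine tsum_congr fun i => ?_
    by_cases h : i ∈ R <;> simp [cut_apply, h]
  · have h : inner ℂ (cut R f) f = inner ℂ (cut R f) (cut R f) := by
      simp only [lp.inner_eq_tsum]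
      refine tsum_congr fun i => ?_
      by_cases h : i ∈ R <;> simp [cut_apply, h]
    rw [h, inner_self_eq_norm_sq_to_K]
    exact_mod_cast (RCLike.ofReal_nonneg (K := ℂ)).2 (sq_nonneg ‖cut R f‖)

theorem re_inner_cut (R : Set E) (f : H0 E) : (inner ℂ f (cut R f)).re = ‖cut R f‖ ^ 2 := by
  have h : inner ℂ f (cut R f) = inner ℂ (cut R f) (cut R f) := by
    simp only [lp.inner_eq_tsum]
    refine tsum_congr fun i => ?_
    by_cases h : i ∈ R <;> simp [cut_apply, h]
  rw [h, inner_self_eq_norm_sq_to_K]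
  norm_cast

theorem norm_sq_cut_add_compl (R : Set E) (f : H0 E) :
    ‖cut R f‖ ^ 2 + ‖cut Rᶜ f‖ ^ 2 = ‖f‖ ^ 2 := by
  refine ((hasSum_norm_sq _).add (hasSum_norm_sq _)).unique ?_
  convert hasSum_norm_sq f using 2 with i
  by_cases hi : i ∈ R <;> simp [cut_apply, hi]

/-- Tails of a convergent series. This is what removes the penalty on Λᶜ in the limit. -/
theorem tendsto_norm_cut_compl (f : H0 E) :
    Tendsto (fun Λ : Finset E => ‖cut ((Λ : Set E)ᶜ) f‖ ^ 2) atTop (𝓝 0) := by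
  have h : ∀ Λ : Finset E, ‖cut ((Λ : Set E)ᶜ) f‖ ^ 2 = ‖f‖ ^ 2 - ∑ i ∈ Λ, ‖f i‖ ^ 2 := by
    intro Λ
    rw [← norm_sq_cut_add_compl (Λ : Set E) f, add_sub_right_comm, right_eq_add, sub_eq_zero]
    refine (hasSum_norm_sq _).unique ?_
    convert hasSum_sum_of_ne_finset_zero (f := fun i => ‖cut (Λ : Set E) f i‖ ^ 2) (s := Λ)
      (L := .unconditional E) ?_ using 1
    · refine Finset.sum_congr rfl fun i hi => ?_
      simp [cut_apply, hi]
    · intro i hi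
      simp [cut_apply, hi]
  simp only [h]
  have := (tendsto_const_nhds (x := ‖f‖ ^ 2)).sub (hasSum_norm_sq f : Tendsto _ _ _)
  simpa using this

/-- If the product of two functions vanishes everywhere they are orthogonal. -/
theorem inner_eq_zero_of_forall {f g : H0 E} (h : ∀ y, f y = 0 ∨ g y = 0) :
    inner ℂ f g = 0 := by
  rw [lp.inner_eq_tsum]
  refine (tsum_congr fun i => ?_).trans tsum_zero
  rcases h i with h | h <;> simp [h]

/-! ### The quadratic form of a positive operator -/

/-- The quadratic form `(u, T u)₀`. -/
def qform (T : H0 E →L[ℂ] H0 E) (u : H0 E) : ℝ := (inner ℂ u (T u)).re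

variable {T : H0 E →L[ℂ] H0 E}

theorem qform_nonneg (hT : T.IsPositive) (u : H0 E) : 0 ≤ qform T u := hT.re_inner_nonneg_right u

theorem qform_le (T : H0 E →L[ℂ] H0 E) (u : H0 E) : qform T u ≤ ‖T‖ * ‖u‖ ^ 2 := by
  calc qform T u ≤ ‖inner ℂ u (T u)‖ := Complex.re_le_norm _
    _ ≤ ‖u‖ * ‖T u‖ := norm_inner_le_norm _ _
    _ ≤ ‖u‖ * (‖T‖ * ‖u‖) := by gcongr; exact T.le_opNorm u
    _ = _ := by ring

theorem qform_add_eq (hT : T.IsPositive) (u v : H0 E) :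
    qform T (u + v) = qform T u + 2 * (inner ℂ v (T u)).re + qform T v := by
  have h : (inner ℂ u (T v)).re = (inner ℂ v (T u)).re := by
    rw [← hT.inner_left_eq_inner_right, ← inner_conj_symm, Complex.conj_re]
  simp only [qform, map_add, inner_add_left, inner_add_right, Complex.add_re, h]
  ring

theorem qform_smul (T : H0 E →L[ℂ] H0 E) (c : ℝ) (u : H0 E) :
    qform T ((c : ℂ) • u) = c ^ 2 * qform T u := by
  simp only [qform, map_smul, inner_smul_left, inner_smul_right, Complex.conj_ofReal]
  rw [← mul_assoc, ← Complex.ofReal_mul, Complex.re_ofReal_mul]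
  ring

theorem qform_parallelogram (hT : T.IsPositive) (u v : H0 E) :
    qform T (u + v) + qform T (u - v) = 2 * qform T u + 2 * qform T v := by
  have h : qform T (-v) = qform T v := by simp [qform]
  rw [sub_eq_add_neg, qform_add_eq hT, qform_add_eq hT, h]
  simp only [inner_neg_left, Complex.neg_re]
  ring

/-- Positivity of the form at √t u - v/√t bounds the cross term. -/
theorem qform_add_le (hT : T.IsPositive) (u v : H0 E) {t : ℝ} (ht : 0 < t) :
    qform T (u + v) ≤ (1 + t) * qform T u + (1 + t⁻¹) * qform T v := by
  have h := qform_nonneg hT ((Real.sqrt t : ℂ) • u + ((-(Real.sqrt t)⁻¹ : ℝ) : ℂ) • v)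
  rw [qform_add_eq hT, qform_smul, qform_smul] at h
  have hs : Real.sqrt t ≠ 0 := (Real.sqrt_pos.2 ht).ne'
  have h2 : (inner ℂ (((-(Real.sqrt t)⁻¹ : ℝ) : ℂ) • v) (T ((Real.sqrt t : ℂ) • u))).re =
      -(inner ℂ v (T u)).re := by
    rw [map_smul, inner_smul_left, inner_smul_right, Complex.conj_ofReal, ← mul_assoc,
      ← Complex.ofReal_mul, Complex.re_ofReal_mul]
    field_simp
  rw [h2, neg_sq, inv_pow, Real.sq_sqrt ht.le] at h
  rw [qform_add_eq hT]
  linarith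

theorem qform_add_op (S T : H0 E →L[ℂ] H0 E) (u : H0 E) :
    qform (S + T) u = qform S u + qform T u := by
  simp [qform]

theorem qform_cut (R : Set E) (u : H0 E) : qform (cut R) u = ‖cut R u‖ ^ 2 := re_inner_cut R u

/-- The form at u - s T u is s² (Tu, T Tu) - 2s ‖Tu‖² and nonnegative; divide by s and let s → 0. -/
theorem apply_eq_zero_of_qform_eq_zero (hT : T.IsPositive) {u : H0 E} (h : qform T u = 0) :
    T u = 0 := by
  rw [← norm_eq_zero, ← sq_eq_zero_iff]
  have key : ∀ s : ℝ, 0 < s → ‖T u‖ ^ 2 ≤ s * qform T (T u) := by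
    intro s hs
    have h1 := qform_nonneg hT (u + ((-s : ℝ) : ℂ) • T u)
    rw [qform_add_eq hT, h, qform_smul, inner_smul_left, Complex.conj_ofReal,
      Complex.re_ofReal_mul, inner_self_eq_norm_sq_to_K] at h1
    have h2 : ((((‖T u‖ : ℝ) : ℂ)) ^ 2).re = ‖T u‖ ^ 2 := by norm_cast
    have h3 : 0 ≤ s * (s * qform T (T u) - 2 * ‖T u‖ ^ 2) := by
      have := h1
      simp only [RCLike.ofReal_eq_complex_ofReal] at this
      rw [h2] at this
      linarith
    have h4 := nonneg_of_mul_nonneg_right h3 hs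
    nlinarith [sq_nonneg ‖T u‖]
  refine le_antisymm (le_of_forall_pos_le_add fun ε hε => ?_) (sq_nonneg _)
  have hq := qform_nonneg hT (T u)
  refine (key (ε / (qform T (T u) + 1)) (by positivity)).trans ?_
  rw [zero_add, div_mul_eq_mul_div, div_le_iff₀ (by positivity)]
  nlinarith

/-! ### The resolvent at `-1` -/

/-- Lax–Milgram: `1 + T` is coercive with constant 1. -/
theorem isUnit_one_add (hT : T.IsPositive) : IsUnit (1 + T) := by
  refine ContinuousLinearMap.isUnit_of_forall_le_norm_inner_map (1 + T) (c := 1) one_pos fun u => ?_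
  have h : ((‖u‖ ^ 2 : ℝ) : ℂ) = inner ℂ u u := by
    rw [inner_self_eq_norm_sq_to_K]; norm_cast
  refine le_trans ?_ (Complex.re_le_norm _)
  rw [add_apply, inner_add_left, one_apply_eq_self, ← h,
    Complex.add_re, Complex.ofReal_re]
  have := hT.re_inner_nonneg_left u
  simp only [NNReal.coe_one, mul_one]
  simpa using this

/-- So I - K is the resolvent (I+A)⁻¹: if u = (I+A)⁻¹w then Kw = Au and (I - K)w = u. -/
theorem dppOperator_add_inverse (hT : T.IsPositive) :
    dppOperator T + Ring.inverse (1 + T) = 1 := by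
  have := Ring.mul_inverse_cancel _ (isUnit_one_add hT)
  rw [add_mul, one_mul] at this
  rw [dppOperator, add_comm, this]

end

section

/-! ### Local marginals as determinants -/

open Classical in
/-- The matrix on `Λ` with the rows of `K` at the sites of `S`, the rows of `I - K` at the sites of
`R` and the rows of `I` elsewhere. -/
def occupationMatrix (K : H0 E →L[ℂ] H0 E) (Λ S R : Finset E) : Matrix Λ Λ ℂ :=
  Matrix.of fun i j => if (i : E) ∈ S then kernel K i j
    else if (i : E) ∈ R then (1 : Matrix Λ Λ ℂ) i j - kernel K i j else (1 : Matrix Λ Λ ℂ) i j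

theorem measurableSet_superset (S : Finset E) :
    MeasurableSet {ζ : Set E | (S : Set E) ⊆ ζ} := by
  have : {ζ : Set E | (S : Set E) ⊆ ζ} = ⋂ x ∈ S, {ζ | x ∈ ζ} := by
    ext ζ; simp [Set.subset_def]
  rw [this]
  exact Finset.measurableSet_biInter _ fun x _ => measurableSet_mem x

theorem measurableSet_superset_disjoint (S R : Finset E) :
    MeasurableSet {ζ : Set E | (S : Set E) ⊆ ζ ∧ ∀ y ∈ R, y ∉ ζ} := by
  have : {ζ : Set E | (S : Set E) ⊆ ζ ∧ ∀ y ∈ R, y ∉ ζ} =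
      {ζ : Set E | (S : Set E) ⊆ ζ} ∩ ⋂ x ∈ R, {ζ | x ∉ ζ} := by
    ext ζ; simp
  rw [this]
  exact (measurableSet_superset S).inter
    (Finset.measurableSet_biInter _ fun x _ => measurableSet_notMem x)

-- The rows outside S are rows of the identity, so the matrix is block triangular with an identity
-- block.
open Classical in
theorem det_occupationMatrix_empty (K : H0 E →L[ℂ] H0 E) {Λ S : Finset E} (hS : S ⊆ Λ) :
    (occupationMatrix K Λ S ∅).det = (Matrix.of fun x y : S => kernel K (x : E) (y : E)).det := by
  rw [Matrix.twoBlockTriangular_det (occupationMatrix K Λ S ∅) (fun i => (i : E) ∈ S)]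
  · have h2 : (occupationMatrix K Λ S ∅).toSquareBlockProp (fun i => ¬ (i : E) ∈ S) = 1 := by
      ext i j
      have hi := i.2
      by_cases hij : i = j
      · subst hij
        simp [Matrix.toSquareBlockProp_def, occupationMatrix, hi]
      · have : i.1 ≠ j.1 := fun h => hij (Subtype.ext h)
        simp [Matrix.toSquareBlockProp_def, occupationMatrix, hi, Matrix.one_apply, hij, this]
    let e : S ≃ {i : Λ // (i : E) ∈ S} :=
      { toFun := fun x => ⟨⟨x, hS x.2⟩, x.2⟩
        invFun := fun i => ⟨i.1, i.2⟩
        left_inv := fun x => rfl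
        right_inv := fun i => rfl }
    rw [h2, Matrix.det_one, mul_one, ← Matrix.det_submatrix_equiv_self e]
    congr 1
    ext i j
    simp [Matrix.toSquareBlockProp_def, occupationMatrix, e]
  · intro i hi j hj
    have : i ≠ j := fun h => hi (h ▸ hj)
    simp [occupationMatrix, hi, Matrix.one_apply, this]

-- Linearity of the determinant in the row of y, which is the sum of a row of I - K and a row of K.
open Classical in
theorem det_occupationMatrix_insert (K : H0 E →L[ℂ] H0 E) {Λ S R : Finset E} {y : E} (hy : y ∈ Λ)
    (hyS : y ∉ S) (hyR : y ∉ R) :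
    (occupationMatrix K Λ S R).det =
      (occupationMatrix K Λ S (insert y R)).det + (occupationMatrix K Λ (insert y S) R).det := by
  let y' : Λ := ⟨y, hy⟩
  let u : Λ → ℂ := fun j => (1 : Matrix Λ Λ ℂ) y' j - kernel K y j
  let v : Λ → ℂ := fun j => kernel K y j
  have h := Matrix.det_updateRow_add (occupationMatrix K Λ S R) y' u v
  convert h using 2
  · ext i j
    by_cases hi : i = y'
    · subst hi
      simp [occupationMatrix, y', hyS, hyR, u, v]
    · rw [Matrix.updateRow_ne hi]
  · congr 1
    ext i j
    by_cases hi : i = y'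
    · subst hi
      simp [occupationMatrix, y', hyS, u]
    · rw [Matrix.updateRow_ne hi]
      have : (i : E) ≠ y := fun h => hi (Subtype.ext h)
      simp [occupationMatrix, this]
  · congr 1
    ext i j
    by_cases hi : i = y'
    · subst hi
      simp [occupationMatrix, y', v]
    · rw [Matrix.updateRow_ne hi]
      have : (i : E) ≠ y := fun h => hi (Subtype.ext h)
      simp [occupationMatrix, this]

-- Inclusion–exclusion one empty site at a time: the event without a condition at y splits according
-- to whether y is occupied, and the determinants split in the same way.
open Classical in
theorem measureReal_superset_disjoint {K : H0 E →L[ℂ] H0 E} {μ : Measure (Set E)}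
    [IsProbabilityMeasure μ] (hμ : IsDPP K μ) {Λ : Finset E} (R : Finset E) :
    R ⊆ Λ → ∀ S ⊆ Λ, Disjoint S R →
      ((μ.real {ζ : Set E | (S : Set E) ⊆ ζ ∧ ∀ y ∈ R, y ∉ ζ} : ℝ) : ℂ) =
        (occupationMatrix K Λ S R).det := by
  induction R using Finset.induction_on with
  | empty =>
    intro _ S hS _
    rw [det_occupationMatrix_empty K hS, ← hμ S]
    simp
  | insert y R hyR ih =>
    intro hR S hS hSR
    have hyΛ : y ∈ Λ := hR (Finset.mem_insert_self _ _)
    have hRΛ : R ⊆ Λ := (Finset.subset_insert _ _).trans hR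
    rw [Finset.disjoint_insert_right] at hSR
    have h1 := ih hRΛ S hS hSR.2
    have h2 := ih hRΛ (insert y S) (Finset.insert_subset hyΛ hS)
      (Finset.disjoint_insert_left.2 ⟨hyR, hSR.2⟩)
    have h3 := det_occupationMatrix_insert K (R := R) hyΛ hSR.1 hyR
    rw [← h1, ← h2] at h3
    rw [← sub_eq_iff_eq_add.2 h3, ← Complex.ofReal_sub]
    congr 1
    rw [eq_sub_iff_add_eq, ← measureReal_union _ (measurableSet_superset_disjoint _ _)]
    · congr 1
      ext ζ
      by_cases hy : y ∈ ζ <;> simp [hy, Set.insert_subset_iff]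
    · rw [Set.disjoint_left]
      rintro ζ ⟨_, h⟩ ⟨h', _⟩
      exact h y (Finset.mem_insert_self _ _) (h' (by simp))

open Classical in
theorem marginal_eq_det {K : H0 E →L[ℂ] H0 E} {μ : Measure (Set E)} [IsProbabilityMeasure μ]
    (hμ : IsDPP K μ) (Λ : Finset E) (ξ : Set E) :
    ((marginal μ Λ ξ : ℝ) : ℂ) =
      (occupationMatrix K Λ (Λ.filter (· ∈ ξ)) (Λ.filter (· ∉ ξ))).det := by
  rw [← measureReal_superset_disjoint hμ _ (Finset.filter_subset _ _) _ (Finset.filter_subset _ _)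
    (Finset.disjoint_filter_filter_not _ _ _), marginal]
  congr 3
  ext ζ
  simp only [Set.ext_iff, Set.mem_inter_iff, Set.subset_def, Finset.coe_filter, Set.mem_ofPred_eq,
    Finset.mem_filter, SetLike.mem_coe]
  grind

/-! ### The local variational problem -/

/-- The vector of `l²(E)` with finitely many given coordinates. -/
def ofFinset {Λ : Finset E} (w : Λ → ℂ) : H0 E := ∑ i : Λ, w i • basisVec (i : E)

theorem ofFinset_apply {Λ : Finset E} (w : Λ → ℂ) (i : Λ) : ofFinset w (i : E) = w i := by
  classical
  simp only [ofFinset, lp.coeFn_sum, Finset.sum_apply, lp.coeFn_smul, Pi.smul_apply,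
    basisVec_apply, smul_eq_mul]
  rw [Finset.sum_eq_single i]
  · simp
  · intro j _ hj
    rw [if_neg fun h => hj (Subtype.ext h.symm), mul_zero]
  · simp

theorem ofFinset_apply_of_notMem {Λ : Finset E} (w : Λ → ℂ) {y : E} (hy : y ∉ Λ) :
    ofFinset w y = 0 := by
  classical
  simp only [ofFinset, lp.coeFn_sum, Finset.sum_apply, lp.coeFn_smul, Pi.smul_apply,
    basisVec_apply, smul_eq_mul]
  refine Finset.sum_eq_zero fun i _ => ?_
  rw [if_neg, mul_zero]
  rintro rfl
  exact hy i.2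

theorem apply_ofFinset (T : H0 E →L[ℂ] H0 E) {Λ : Finset E} (w : Λ → ℂ) (y : E) :
    T (ofFinset w) y = ∑ i : Λ, kernel T y i * w i := by
  simp only [ofFinset, map_sum, map_smul, lp.coeFn_sum, Finset.sum_apply, lp.coeFn_smul,
    Pi.smul_apply, smul_eq_mul, kernel_eq]
  exact Finset.sum_congr rfl fun i _ => mul_comm _ _

variable {A : H0 E →L[ℂ] H0 E}

open Classical in
/-- The action of the occupation matrix in terms of `U = (I + A)⁻¹ w`. -/
theorem occupationMatrix_mulVec (hA : A.IsPositive) {Λ : Finset E} (w : Λ → ℂ) (ξ : Set E) :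
    ∃ U : H0 E, (U + A U = ofFinset w) ∧
      ∀ i : Λ, (occupationMatrix (dppOperator A) Λ (Λ.filter (· ∈ ξ))
        (Λ.filter (· ∉ ξ))).mulVec w i = if (i : E) ∈ ξ then A U i else U i := by
  set W := ofFinset w
  have h1 : (1 + A) (Ring.inverse (1 + A) W) = W := by
    have := congrArg (fun T : H0 E →L[ℂ] H0 E => T W)
      (Ring.mul_inverse_cancel _ (isUnit_one_add hA))
    simpa using this
  have h2 : dppOperator A W + Ring.inverse (1 + A) W = W := by
    have := congrArg (fun T : H0 E →L[ℂ] H0 E => T W) (dppOperator_add_inverse hA)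
    simpa using this
  refine ⟨Ring.inverse (1 + A) W, by simpa using h1, fun i => ?_⟩
  have hK : ∑ j : Λ, kernel (dppOperator A) i j * w j = dppOperator A W i :=
    (apply_ofFinset _ _ _).symm
  by_cases hi : (i : E) ∈ ξ
  · rw [if_pos hi]
    simp only [Matrix.mulVec, dotProduct, occupationMatrix, Matrix.of_apply, Finset.mem_filter,
      i.2, hi, and_self, if_true]
    rw [hK]
    rfl
  · rw [if_neg hi]
    simp only [Matrix.mulVec, dotProduct, occupationMatrix, Matrix.of_apply, Finset.mem_filter,
      i.2, hi, and_false, if_false, not_false_eq_true, and_self, if_true, sub_mul,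
      Finset.sum_sub_distrib, hK, Matrix.one_apply]
    simp only [ite_mul, one_mul, zero_mul, Finset.sum_ite_eq, Finset.mem_univ, if_true]
    rw [sub_eq_iff_eq_add', ← ofFinset_apply w i]
    change W i = _
    nth_rw 1 [← h2]
    rfl

-- If w is in the kernel and U = (I+A)⁻¹w, then at every site U or (A + 1_{Λᶜ})U vanishes. Hence (U,
-- AU) = 0, so U = 0 because A is injective, and w = U + AU = 0 on Λ.
open Classical in
theorem det_occupationMatrix_ne_zero (hA : A.IsPositive)
    (hker : LinearMap.ker (A : H0 E →ₗ[ℂ] H0 E) = ⊥) (Λ : Finset E) (ξ : Set E) :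
    (occupationMatrix (dppOperator A) Λ (Λ.filter (· ∈ ξ)) (Λ.filter (· ∉ ξ))).det ≠ 0 := by
  intro h
  obtain ⟨w, hw, hw0⟩ := Matrix.exists_mulVec_eq_zero_iff.2 h
  obtain ⟨U, hU, hM⟩ := occupationMatrix_mulVec hA w ξ
  simp only [hw0, Pi.zero_apply] at hM
  have hpos : (A + cut ((Λ : Set E)ᶜ)).IsPositive := hA.add (cut_isPositive _)
  have h0 : qform (A + cut ((Λ : Set E)ᶜ)) U = 0 := by
    rw [qform, inner_eq_zero_of_forall, Complex.zero_re]
    intro y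
    by_cases hy : y ∈ Λ
    · have := hM ⟨y, hy⟩
      by_cases hyξ : y ∈ ξ
      · right
        simpa [cut_apply, hy, hyξ] using this.symm
      · left
        simpa [hyξ] using this.symm
    -- Outside Λ the vector U + AU vanishes, which is the equation (A + 1_{Λᶜ})U = 0 there.
    · right
      have := ofFinset_apply_of_notMem w hy
      rw [← hU] at this
      simpa [cut_apply, hy, add_comm] using this
  have h1 : qform A U = 0 := by
    rw [qform_add_op, qform_cut] at h0
    have := qform_nonneg hA U
    nlinarith [sq_nonneg ‖cut ((Λ : Set E)ᶜ) U‖]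
  have h2 : U = 0 := by
    have : U ∈ LinearMap.ker (A : H0 E →ₗ[ℂ] H0 E) := apply_eq_zero_of_qform_eq_zero hA h1
    rwa [hker, Submodule.mem_bot] at this
  refine hw (funext fun i => ?_)
  rw [← ofFinset_apply w i, ← hU, h2]
  simp

theorem marginal_pos {μ : Measure (Set E)} [IsProbabilityMeasure μ] (hA : A.IsPositive)
    (hker : LinearMap.ker (A : H0 E →ₗ[ℂ] H0 E) = ⊥) (hμ : IsDPP (dppOperator A) μ)
    (Λ : Finset E) (ξ : Set E) : 0 < marginal μ Λ ξ := by
  refine lt_of_le_of_ne measureReal_nonneg fun h => det_occupationMatrix_ne_zero hA hker Λ ξ ?_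
  rw [← marginal_eq_det hμ, ← h, Complex.ofReal_zero]

/-- Square summable functions with value `1` at `x` that vanish on `R` except perhaps at `x`. -/
def competitors (x : E) (R : Set E) : Set (H0 E) := {u | u x = 1 ∧ ∀ y ∈ R, y ≠ x → u y = 0}

/-- The local Papangelou intensity is the minimum of `(u, A u) + ‖u‖²_{l²(Λᶜ)}` over the functions
`u` with `u(x) = 1` that vanish on `Λ \ xξ`. -/
theorem localPapangelou_isLeast {μ : Measure (Set E)} [IsProbabilityMeasure μ] (hA : A.IsPositive)
    (hker : LinearMap.ker (A : H0 E →ₗ[ℂ] H0 E) = ⊥) (hμ : IsDPP (dppOperator A) μ)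
    {Λ : Finset E} {x : E} {ξ : Set E} (hxΛ : x ∈ Λ) (hx : x ∉ ξ) :
    IsLeast (qform (A + cut ((Λ : Set E)ᶜ)) '' competitors x ((Λ : Set E) \ ξ))
      (localPapangelou μ Λ x ξ) := by
  classical
  set M := occupationMatrix (dppOperator A) Λ (Λ.filter (· ∈ ξ)) (Λ.filter (· ∉ ξ)) with hMdef
  set x' : Λ := ⟨x, hxΛ⟩ with hx'
  have hdet : M.det ≠ 0 := det_occupationMatrix_ne_zero hA hker Λ ξ
  have hunit : IsUnit M.det := isUnit_iff_ne_zero.2 hdet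
  -- The minimizer will be U = (I+A)⁻¹w; the equation Mw = e_x encodes both its constraints and its
  -- Euler–Lagrange equations.
  set w : Λ → ℂ := M⁻¹.mulVec (Pi.single x' 1) with hw
  have hMw : M.mulVec w = Pi.single x' 1 := by
    rw [hw, Matrix.mulVec_mulVec, Matrix.mul_nonsing_inv _ hunit, Matrix.one_mulVec]
  obtain ⟨U, hU, hM⟩ := occupationMatrix_mulVec hA w ξ
  rw [← hMdef, hMw] at hM
  have hUx : U x = 1 := by
    have := hM x'
    rwa [Pi.single_eq_same, if_neg hx, eq_comm] at this
  have hUcomp : U ∈ competitors x ((Λ : Set E) \ ξ) := by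
    refine ⟨hUx, fun y hy hyx => ?_⟩
    have := hM ⟨y, hy.1⟩
    rw [if_neg hy.2, Pi.single_eq_of_ne] at this
    · exact this.symm
    · exact fun h => hyx (congrArg Subtype.val h)
  -- Euler–Lagrange equations at the sites, other than x, where competitors are unconstrained.
  have hBU : ∀ y, y ≠ x → (y ∈ ξ ∨ y ∉ Λ) → (A + cut ((Λ : Set E)ᶜ)) U y = 0 := by
    intro y hyx hy
    by_cases hyΛ : y ∈ Λ
    · have hyξ : y ∈ ξ := hy.resolve_right (not_not.2 hyΛ)
      have := hM ⟨y, hyΛ⟩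
      rw [if_pos hyξ, Pi.single_eq_of_ne] at this
      · simpa [cut_apply, hyΛ] using this.symm
      · exact fun h => hyx (congrArg Subtype.val h)
    · have := ofFinset_apply_of_notMem w hyΛ
      rw [← hU] at this
      simpa [cut_apply, hyΛ, add_comm] using this
  have hval : ((localPapangelou μ Λ x ξ : ℝ) : ℂ) = A U x := by
    rw [localPapangelou, Complex.ofReal_div, marginal_eq_det hμ, marginal_eq_det hμ,
      div_eq_iff hdet]
    have hKw : A U x = ∑ j : Λ, kernel (dppOperator A) x j * w j := by
      rw [← apply_ofFinset, ← hU, dppOperator]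
      have h1 : Ring.inverse (1 + A) (U + A U) = U := by
        have := congrArg (fun T : H0 E →L[ℂ] H0 E => T U)
          (Ring.inverse_mul_cancel _ (isUnit_one_add hA))
        simpa using this
      change A U x = A (Ring.inverse (1 + A) (U + A U)) x
      rw [h1]
    -- Occupying x only replaces the row of x in M by a row of K, so Cramer's rule gives the
    -- quotient as that row applied to w, that is, (AU)(x).
    refine (congrArg Matrix.det
      (a₂ := M.updateRow x' fun j => kernel (dppOperator A) x j) ?_).trans ?_
    · ext i j
      by_cases hi : i = x'
      · subst hi
        simp [occupationMatrix, hx']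
      · rw [Matrix.updateRow_ne hi]
        have : (i : E) ≠ x := fun h => hi (Subtype.ext h)
        simp [hMdef, occupationMatrix, this]
    rw [← Matrix.cramer_transpose_apply, hKw, Finset.sum_mul]
    have hw2 : ∀ j, w j * M.det = M.adjugate j x' := by
      intro j
      rw [hw, Matrix.inv_def, Matrix.smul_mulVec, Pi.smul_apply, smul_eq_mul,
        Matrix.mulVec_single_one, Matrix.col_apply, Ring.inverse_eq_inv']
      field_simp
    rw [Matrix.cramer_eq_adjugate_mulVec, ← Matrix.adjugate_transpose]
    simp only [Matrix.mulVec, dotProduct, Matrix.transpose_apply]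
    refine Finset.sum_congr rfl fun j _ => ?_
    rw [mul_assoc, hw2, mul_comm]
  have hpos : (A + cut ((Λ : Set E)ᶜ)).IsPositive := hA.add (cut_isPositive _)
  have hinner : inner ℂ U ((A + cut ((Λ : Set E)ᶜ)) U) = A U x := by
    rw [lp.inner_eq_tsum, tsum_eq_single x]
    · simp [hUx, cut_apply, hxΛ]
    · intro y hyx
      by_cases hy : y ∈ ξ ∨ y ∉ Λ
      · rw [hBU y hyx hy, inner_zero_right]
      · push Not at hy
        rw [hUcomp.2 y ⟨hy.2, hy.1⟩ hyx, inner_zero_left]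
  have hqU : qform (A + cut ((Λ : Set E)ᶜ)) U = localPapangelou μ Λ x ξ := by
    rw [qform, hinner, ← hval, Complex.ofReal_re]
  refine ⟨⟨U, hUcomp, hqU⟩, ?_⟩
  rintro _ ⟨u, hu, rfl⟩
  -- At each site either both competitors agree or the Euler–Lagrange equation holds, so there is no
  -- cross term and U minimizes.
  have horth : inner ℂ (u - U) ((A + cut ((Λ : Set E)ᶜ)) U) = 0 := by
    refine inner_eq_zero_of_forall fun y => ?_
    by_cases hyx : y = x
    · left
      subst hyx
      simp [hu.1, hUx]
    by_cases hy : y ∈ ξ ∨ y ∉ Λ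
    · exact Or.inr (hBU y hyx hy)
    · push Not at hy
      left
      simp [hu.2 y ⟨hy.2, hy.1⟩ hyx, hUcomp.2 y ⟨hy.2, hy.1⟩ hyx]
  have := qform_add_eq hpos U (u - U)
  rw [add_sub_cancel, horth, hqU] at this
  rw [this]
  have := qform_nonneg hpos (u - U)
  simp [this]

end

section

variable {A : H0 E →L[ℂ] H0 E}

/-! ### The limit of the local Papangelou intensities -/

theorem basisVec_mem_competitors (x : E) (R : Set E) : basisVec x ∈ competitors x R :=
  ⟨by simp [basisVec_apply], fun y _ hy => by simp [basisVec_apply, hy]⟩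

theorem competitors_anti {x : E} {R S : Set E} (h : R ⊆ S) :
    competitors x S ⊆ competitors x R := fun _ hu => ⟨hu.1, fun y hy => hu.2 y (h hy)⟩

theorem half_add_mem_competitors {x : E} {R : Set E} {u v : H0 E} (hu : u ∈ competitors x R)
    (hv : v ∈ competitors x R) : (((1 / 2 : ℝ) : ℂ)) • (u + v) ∈ competitors x R := by
  refine ⟨?_, fun y hy hyx => ?_⟩
  · change ((1 / 2 : ℝ) : ℂ) * (u x + v x) = 1
    rw [hu.1, hv.1]
    norm_num
  · change ((1 / 2 : ℝ) : ℂ) * (u y + v y) = 0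
    rw [hu.2 y hy hyx, hv.2 y hy hyx, add_zero, mul_zero]

theorem bddBelow_qform {T : H0 E →L[ℂ] H0 E} (hT : T.IsPositive) (S : Set (H0 E)) :
    BddBelow (qform T '' S) := ⟨0, by rintro _ ⟨u, _, rfl⟩; exact qform_nonneg hT u⟩

/-- The variational expression `inf (u, A u)` over the functions supported on `xξ` with
`u(x) = 1`. -/
def papangelouInf (A : H0 E →L[ℂ] H0 E) (x : E) (ξ : Set E) : ℝ :=
  sInf (qform A '' competitors x ξᶜ)

theorem papangelouInf_le (hA : A.IsPositive) {x : E} {ξ : Set E} {u : H0 E}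
    (hu : u ∈ competitors x ξᶜ) : papangelouInf A x ξ ≤ qform A u :=
  csInf_le (bddBelow_qform hA _) ⟨u, hu, rfl⟩

theorem papangelouInf_le_norm (hA : A.IsPositive) (x : E) (ξ : Set E) :
    papangelouInf A x ξ ≤ ‖A‖ := by
  refine (papangelouInf_le hA (basisVec_mem_competitors x _)).trans ?_
  simpa [norm_basisVec] using qform_le A (basisVec x)

/-- The infimum over the functions that vanish on `Λ \ xξ`, penalized by the `l²` norm outside
`xξ`. -/
def penalizedInf (A : H0 E →L[ℂ] H0 E) (x : E) (ξ : Set E) (Λ : Finset E) : ℝ :=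
  sInf (qform (A + cut (insert x ξ)ᶜ) '' competitors x ((Λ : Set E) \ ξ))

/-- With the penalty outside xξ the functional no longer depends on Λ; only the constraint tightens
as Λ grows. -/
theorem penalizedInf_mono (hA : A.IsPositive) (x : E) (ξ : Set E) :
    Monotone (penalizedInf A x ξ) := fun Λ Λ' h => by
  refine csInf_le_csInf (bddBelow_qform (hA.add (cut_isPositive _)) _)
    ⟨_, ⟨_, basisVec_mem_competitors x _, rfl⟩⟩ (Set.image_mono (competitors_anti ?_))
  exact Set.sdiff_subset_sdiff_left (Finset.coe_subset.2 h)

theorem bddAbove_penalizedInf (hA : A.IsPositive) (x : E) (ξ : Set E) :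
    BddAbove (Set.range (penalizedInf A x ξ)) := by
  refine ⟨qform (A + cut (insert x ξ)ᶜ) (basisVec x), ?_⟩
  rintro _ ⟨Λ, rfl⟩
  exact csInf_le (bddBelow_qform (hA.add (cut_isPositive _)) _)
    ⟨_, basisVec_mem_competitors x _, rfl⟩

/-- Near minimizers u, u' for windows Λ₀ ⊆ Λ are close in the penalized form by the parallelogram
law. As u' vanishes on Λ \ xξ, u is small there; as Λ is chosen after u, the rest of u outside xξ is
a small tail. -/
theorem exists_competitor_norm_cut_le (hA : A.IsPositive) (x : E) (ξ : Set E) {ε : ℝ}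
    (hε : 0 < ε) :
    ∃ u : H0 E, u x = 1 ∧ qform A u ≤ (⨆ Λ, penalizedInf A x ξ Λ) + ε ∧
      ‖cut (insert x ξ)ᶜ u‖ ^ 2 ≤ 9 * ε := by
  set B := A + cut (insert x ξ)ᶜ with hB
  have hpos : B.IsPositive := hA.add (cut_isPositive _)
  set L := ⨆ Λ, penalizedInf A x ξ Λ with hL
  have hle : ∀ Λ, penalizedInf A x ξ Λ ≤ L := le_ciSup (bddAbove_penalizedInf hA x ξ)
  have hnear : ∀ Λ : Finset E, ∃ u ∈ competitors x ((Λ : Set E) \ ξ), qform B u < L + ε := by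
    intro Λ
    obtain ⟨_, ⟨u, hu, rfl⟩, hlt⟩ := exists_lt_of_csInf_lt
      (s := qform B '' competitors x ((Λ : Set E) \ ξ)) ⟨_, ⟨_, basisVec_mem_competitors x _, rfl⟩⟩
      (lt_of_le_of_lt (hle Λ) (lt_add_of_pos_right L hε))
    exact ⟨u, hu, hlt⟩
  have hsplit : ∀ v, qform B v = qform A v + ‖cut (insert x ξ)ᶜ v‖ ^ 2 := fun v => by
    rw [hB, qform_add_op, qform_cut]
  obtain ⟨Λ₀, hΛ₀⟩ := exists_lt_of_lt_ciSup (sub_lt_self L hε)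
  obtain ⟨u, hu, huL⟩ := hnear Λ₀
  refine ⟨u, hu.1, ?_, ?_⟩
  · have := hsplit u
    nlinarith [sq_nonneg ‖cut (insert x ξ)ᶜ u‖]
  set p := cut (insert x ξ)ᶜ u with hp
  obtain ⟨Λ, hΛ, hΛp⟩ := ((eventually_ge_atTop Λ₀).and
    ((tendsto_norm_cut_compl p).eventually (gt_mem_nhds hε))).exists
  obtain ⟨u', hu', hu'L⟩ := hnear Λ
  have hu'₀ : u' ∈ competitors x ((Λ₀ : Set E) \ ξ) :=
    competitors_anti (Set.sdiff_subset_sdiff_left (Finset.coe_subset.2 hΛ)) hu'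
  have hmid : L - ε < qform B (((1 / 2 : ℝ) : ℂ) • (u + u')) :=
    lt_of_lt_of_le hΛ₀ (csInf_le (bddBelow_qform hpos _) ⟨_, half_add_mem_competitors hu hu'₀, rfl⟩)
  rw [qform_smul] at hmid
  have hpar := qform_parallelogram hpos u u'
  -- Parallelogram law: 2B(u) + 2B(u') < 4(L + ε), while B(u + u') = 4B((u + u')/2) > 4(L - ε). The
  -- tail outside Λ then adds ε, whence the constant 9.
  have hdiff : qform B (u - u') ≤ 8 * ε := by linarith
  have hcut : ‖cut (Λ : Set E) p‖ ^ 2 ≤ 8 * ε := by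
    refine le_trans ?_ hdiff
    rw [hsplit]
    have h1 : ‖cut (Λ : Set E) p‖ ≤ ‖cut (insert x ξ)ᶜ (u - u')‖ := by
      refine lp.norm_mono (by norm_num) fun y => ?_
      by_cases hy : y ∈ Λ
      · by_cases hyξ : y ∈ insert x ξ
        · simp [cut_apply, hp, hyξ]
        · have h0 : u' y = 0 :=
            hu'.2 y ⟨hy, fun h => hyξ (Or.inr h)⟩ fun h => hyξ (Or.inl h)
          simp only [cut_apply, hp, SetLike.mem_coe, hy, if_true, Set.mem_compl_iff, hyξ,
            not_false_eq_true, lp.coeFn_sub, Pi.sub_apply, h0, sub_zero]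
          exact le_rfl
      · simp [cut_apply, hy]
    have h2 := qform_nonneg hA (u - u')
    have h3 := norm_nonneg (cut (Λ : Set E) p)
    nlinarith
  rw [← norm_sq_cut_add_compl (Λ : Set E) p]
  linarith

/-- Deleting the small part outside xξ from a near minimizer gives a function admissible for
`papangelouInf`, at a cost controlled by `qform_add_le`. -/
theorem papangelouInf_le_iSup (hA : A.IsPositive) (x : E) (ξ : Set E) :
    papangelouInf A x ξ ≤ ⨆ Λ, penalizedInf A x ξ Λ := by
  set L := ⨆ Λ, penalizedInf A x ξ Λ with hL
  have key : ∀ t : ℝ, 0 < t → ∀ ε : ℝ, 0 < ε →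
      papangelouInf A x ξ ≤ (1 + t) * (L + ε) + (1 + t⁻¹) * (‖A‖ * (9 * ε)) := by
    intro t ht ε hε
    obtain ⟨u, hux, hu1, hu2⟩ := exists_competitor_norm_cut_le hA x ξ hε
    set p := cut (insert x ξ)ᶜ u with hp
    have hmem : u + -p ∈ competitors x ξᶜ := by
      refine ⟨by simp [hp, cut_apply, hux], fun y hy hyx => ?_⟩
      have : y ∉ insert x ξ := fun h => h.elim hyx hy
      simp [hp, cut_apply, this]
    refine (papangelouInf_le hA hmem).trans ((qform_add_le hA _ _ ht).trans ?_)
    have h1 : qform A (-p) ≤ ‖A‖ * (9 * ε) := by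
      refine (qform_le A _).trans ?_
      rw [norm_neg]
      gcongr
    gcongr
  -- The order of the limits matters: ε → 0 with t fixed, because of the factor 1 + t⁻¹, and only
  -- then t → 0.
  have key2 : ∀ t : ℝ, 0 < t → papangelouInf A x ξ ≤ (1 + t) * L := by
    intro t ht
    have hc : Continuous fun ε : ℝ => (1 + t) * (L + ε) + (1 + t⁻¹) * (‖A‖ * (9 * ε)) := by
      fun_prop
    have h := hc.tendsto 0
    simp only [add_zero, mul_zero] at h
    exact ge_of_tendsto (h.mono_left (nhdsWithin_le_nhds (s := Set.Ioi 0)))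
      (eventually_nhdsWithin_of_forall fun ε hε => key t ht ε hε)
  have hc : Continuous fun t : ℝ => (1 + t) * L := by fun_prop
  have h := hc.tendsto 0
  simp only [add_zero, one_mul] at h
  exact ge_of_tendsto (h.mono_left (nhdsWithin_le_nhds (s := Set.Ioi 0)))
    (eventually_nhdsWithin_of_forall fun t ht => key2 t ht)

section Papangelou

variable {μ : Measure (Set E)} [IsProbabilityMeasure μ]

/-- The local minimizer vanishes on Λ \ xξ, so its mass outside xξ lies outside Λ and the new
penalty is at most the old one. -/
theorem penalizedInf_le_localPapangelou (hA : A.IsPositive)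
    (hker : LinearMap.ker (A : H0 E →ₗ[ℂ] H0 E) = ⊥) (hμ : IsDPP (dppOperator A) μ)
    {Λ : Finset E} {x : E} {ξ : Set E} (hxΛ : x ∈ Λ) (hx : x ∉ ξ) :
    penalizedInf A x ξ Λ ≤ localPapangelou μ Λ x ξ := by
  obtain ⟨⟨U, hU, hUq⟩, -⟩ := localPapangelou_isLeast hA hker hμ hxΛ hx
  rw [← hUq]
  refine (csInf_le (bddBelow_qform (hA.add (cut_isPositive _)) _) ⟨U, hU, rfl⟩).trans ?_
  rw [qform_add_op, qform_add_op, qform_cut, qform_cut]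
  gcongr 2
  refine lp.norm_mono (by norm_num) fun y => ?_
  by_cases hy : y ∈ Λ
  · by_cases hyξ : y ∈ insert x ξ
    · simp [cut_apply, hyξ]
    · have h0 : U y = 0 := hU.2 y ⟨hy, fun h => hyξ (Or.inr h)⟩ fun h => hyξ (Or.inl h)
      simp [cut_apply, h0]
  · by_cases hyξ : y ∈ insert x ξ <;> simp [cut_apply, hy, hyξ]

/-- Below, the increasing penalized infima; above, a fixed near minimizer supported on xξ, whose
penalty on Λᶜ tends to zero. -/
theorem tendsto_localPapangelou (hA : A.IsPositive)
    (hker : LinearMap.ker (A : H0 E →ₗ[ℂ] H0 E) = ⊥) (hμ : IsDPP (dppOperator A) μ)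
    {x : E} {ξ : Set E} (hx : x ∉ ξ) :
    Tendsto (fun Λ : Finset E => localPapangelou μ Λ x ξ) atTop (𝓝 (papangelouInf A x ξ)) := by
  have hxev : ∀ᶠ Λ : Finset E in atTop, x ∈ Λ := by
    filter_upwards [eventually_ge_atTop {x}] with Λ h
    exact h (Finset.mem_singleton_self x)
  rw [tendsto_order]
  refine ⟨fun a ha => ?_, fun a ha => ?_⟩
  · have := tendsto_atTop_ciSup (penalizedInf_mono hA x ξ) (bddAbove_penalizedInf hA x ξ)
    filter_upwards [hxev, this.eventually (lt_mem_nhds (ha.trans_le (papangelouInf_le_iSup hA x ξ)))]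
      with Λ h1 h2
    exact h2.trans_le (penalizedInf_le_localPapangelou hA hker hμ h1 hx)
  · obtain ⟨_, ⟨u, hu, rfl⟩, hlt⟩ := exists_lt_of_csInf_lt
      (s := qform A '' competitors x ξᶜ) ⟨_, ⟨_, basisVec_mem_competitors x _, rfl⟩⟩ ha
    have h := (tendsto_norm_cut_compl u).const_add (qform A u)
    rw [add_zero] at h
    filter_upwards [hxev, h.eventually (gt_mem_nhds hlt)] with Λ h1 h2
    refine lt_of_le_of_lt ((localPapangelou_isLeast hA hker hμ h1 hx).2 ⟨u, ?_, rfl⟩) ?_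
    · exact competitors_anti (fun y hy => hy.2) hu
    · rwa [qform_add_op, qform_cut]

/-- The test function e_x has no penalty because x ∈ Λ. This uniform bound is the dominating
constant for the GNZ limit. -/
theorem localPapangelou_le_norm (hA : A.IsPositive)
    (hker : LinearMap.ker (A : H0 E →ₗ[ℂ] H0 E) = ⊥) (hμ : IsDPP (dppOperator A) μ)
    {Λ : Finset E} {x : E} {ξ : Set E} (hxΛ : x ∈ Λ) (hx : x ∉ ξ) :
    localPapangelou μ Λ x ξ ≤ ‖A‖ := by
  refine ((localPapangelou_isLeast hA hker hμ hxΛ hx).2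
    ⟨_, basisVec_mem_competitors x _, rfl⟩).trans ?_
  have h0 : cut ((Λ : Set E)ᶜ) (basisVec x) = 0 := by
    ext y
    by_cases hy : y ∈ Λ
    · simp [cut_apply, hy]
    · have : y ≠ x := fun h => hy (h ▸ hxΛ)
      simp [cut_apply, basisVec_apply, this]
  rw [qform_add_op, qform_cut, h0]
  simpa [norm_basisVec] using qform_le A (basisVec x)

theorem papangelou_eq (hA : A.IsPositive)
    (hker : LinearMap.ker (A : H0 E →ₗ[ℂ] H0 E) = ⊥) (hμ : IsDPP (dppOperator A) μ)
    {x : E} {ξ : Set E} (hx : x ∉ ξ) : papangelou μ x ξ = papangelouInf A x ξ :=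
  (tendsto_localPapangelou hA hker hμ hx).limUnder_eq

/-- Off its meaningful domain the quotient is constant, so the limit exists at every ξ and α(x; ·)
is a pointwise limit everywhere. -/
theorem localPapangelou_of_mem (hA : A.IsPositive)
    (hker : LinearMap.ker (A : H0 E →ₗ[ℂ] H0 E) = ⊥) (hμ : IsDPP (dppOperator A) μ)
    (Λ : Finset E) {x : E} {ξ : Set E} (hx : x ∈ ξ) : localPapangelou μ Λ x ξ = 1 := by
  rw [localPapangelou, Set.insert_eq_of_mem hx]
  exact div_self (marginal_pos hA hker hμ Λ ξ).ne'

theorem tendsto_localPapangelou_papangelou (hA : A.IsPositive)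
    (hker : LinearMap.ker (A : H0 E →ₗ[ℂ] H0 E) = ⊥) (hμ : IsDPP (dppOperator A) μ)
    (x : E) (ξ : Set E) :
    Tendsto (fun Λ : Finset E => localPapangelou μ Λ x ξ) atTop (𝓝 (papangelou μ x ξ)) := by
  refine tendsto_nhds_limUnder ?_
  by_cases hx : x ∈ ξ
  · exact ⟨1, tendsto_const_nhds.congr fun Λ => (localPapangelou_of_mem hA hker hμ Λ hx).symm⟩
  · exact ⟨_, tendsto_localPapangelou hA hker hμ hx⟩

theorem papangelou_le_norm (hA : A.IsPositive)
    (hker : LinearMap.ker (A : H0 E →ₗ[ℂ] H0 E) = ⊥) (hμ : IsDPP (dppOperator A) μ)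
    {x : E} {ξ : Set E} (hx : x ∉ ξ) : papangelou μ x ξ ≤ ‖A‖ := by
  rw [papangelou_eq hA hker hμ hx]
  exact papangelouInf_le_norm hA x ξ

end Papangelou

/-! ### Consequences of functional completeness -/

theorem norm_toPreMinus_sq (hA : A.IsPositive) (u : H0 E) :
    ‖toPreMinus A hA u‖ ^ 2 = qform A u := by
  rw [@norm_sq_eq_re_inner ℂ]
  rfl

/-- Under hypothesis (H) point evaluations are bounded for `‖·‖₋`. -/
theorem HypothesisH.exists_dual_vector {hA : A.IsPositive} (hH : HypothesisH A hA) (x : E) :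
    ∃ v : HMinus A hA, ∀ u : H0 E, inner ℂ v (toPreMinus A hA u : HMinus A hA) = u x := by
  obtain ⟨J, -, hcont, hJ⟩ := hH
  let φ : StrongDual ℂ (HMinus A hA) := ⟨(LinearMap.proj x).comp J, hcont x⟩
  refine ⟨(InnerProductSpace.toDual ℂ _).symm φ, fun u => ?_⟩
  rw [InnerProductSpace.toDual_symm_apply]
  exact hJ u x

theorem HypothesisH.exists_norm_sq_le {hA : A.IsPositive} (hH : HypothesisH A hA) (x : E) :
    ∃ C : ℝ, 0 < C ∧ ∀ u : H0 E, ‖u x‖ ^ 2 ≤ C * qform A u := by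
  obtain ⟨v, hv⟩ := hH.exists_dual_vector x
  -- Cauchy–Schwarz gives ‖v‖²; adding 1 makes the constant positive.
  refine ⟨‖v‖ ^ 2 + 1, by positivity, fun u => ?_⟩
  have h : ‖u x‖ ≤ ‖v‖ * ‖toPreMinus A hA u‖ := by
    rw [← hv u, ← UniformSpace.Completion.norm_coe (toPreMinus A hA u)]
    exact norm_inner_le_norm _ _
  calc ‖u x‖ ^ 2 ≤ (‖v‖ * ‖toPreMinus A hA u‖) ^ 2 := by gcongr
    _ = ‖v‖ ^ 2 * qform A u := by rw [mul_pow, norm_toPreMinus_sq]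
    _ ≤ _ := by
      have := qform_nonneg hA u
      gcongr
      linarith

/-- Every competitor satisfies 1 = |u(x)|² ≤ C (u, Au), so the infimum is at least 1/C. -/
theorem papangelouInf_pos {hA : A.IsPositive} (hH : HypothesisH A hA) (x : E) (ξ : Set E) :
    0 < papangelouInf A x ξ := by
  obtain ⟨C, hC, h⟩ := hH.exists_norm_sq_le x
  refine (inv_pos.2 hC).trans_le (le_csInf ⟨_, ⟨_, basisVec_mem_competitors x _, rfl⟩⟩ ?_)
  rintro _ ⟨u, hu, rfl⟩
  have := h u
  rw [hu.1, norm_one, one_pow] at this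
  rwa [inv_le_iff_one_le_mul₀' hC]

/-! ### The dual variational quantity -/

section Dual

variable (hA : A.IsPositive) (hker : LinearMap.ker (A : H0 E →ₗ[ℂ] H0 E) = ⊥)

/-- (Au, A⁻¹Av)₀ = (u, Av)₀: the operator A is isometric for the two inner products. -/
theorem inner_toPrePlus (u v : H0 E) :
    inner ℂ (toPrePlus A hA hker u) (toPrePlus A hA hker v) =
      inner ℂ (toPreMinus A hA u) (toPreMinus A hA v) := by
  change inner ℂ (prePlusVal A hA hker (toPrePlus A hA hker u))
    ((toPrePlus A hA hker).symm (toPrePlus A hA hker v)) = inner ℂ u (A v)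
  rw [prePlusVal_eq, LinearEquiv.symm_apply_apply, LinearEquiv.symm_apply_apply]
  exact hA.isSymmetric u v

/-- The isometry from `H₋` to `H₊` that extends `A`. -/
def minusToPlus : HMinus A hA →L[ℂ] HPlus A hA hker :=
  ((UniformSpace.Completion.toComplL (𝕜 := ℂ)).comp
    (LinearIsometry.toContinuousLinearMap
      (LinearMap.isometryOfInner
        ((toPrePlus A hA hker).toLinearMap.comp (toPreMinus A hA).symm.toLinearMap)
        fun _ _ => inner_toPrePlus hA hker _ _))).extend
    (UniformSpace.Completion.toComplL (𝕜 := ℂ))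

theorem minusToPlus_coe (u : H0 E) :
    minusToPlus hA hker (toPreMinus A hA u : HMinus A hA) =
      ((toPrePlus A hA hker u : PrePlus A hA hker) : HPlus A hA hker) :=
  ContinuousLinearMap.extend_eq _ UniformSpace.Completion.denseRange_coe
    (UniformSpace.Completion.isUniformInducing_coe _) _

theorem inner_minusToPlus (u : H0 E) (v : HMinus A hA) :
    inner ℂ ((toPrePlus A hA hker u : PrePlus A hA hker) : HPlus A hA hker)
      (minusToPlus hA hker v) = inner ℂ (toPreMinus A hA u : HMinus A hA) v := by
  induction v using UniformSpace.Completion.induction_on with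
  | hp => exact isClosed_eq (by fun_prop) (by fun_prop)
  | ih v =>
    obtain ⟨v, rfl⟩ := (toPreMinus A hA).surjective v
    rw [minusToPlus_coe, UniformSpace.Completion.inner_coe, UniformSpace.Completion.inner_coe,
      inner_toPrePlus]

open Classical in
/-- Under hypothesis (H) the function `e_x` belongs to `H₊`. -/
theorem HypothesisH.exists_plusFun_eq_single {hA : A.IsPositive} (hH : HypothesisH A hA)
    (hker : LinearMap.ker (A : H0 E →ₗ[ℂ] H0 E) = ⊥) (x : E) :
    ∃ v : HPlus A hA hker, plusFun A hA hker v = Pi.single x 1 := by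
  obtain ⟨v, hv⟩ := hH.exists_dual_vector x
  refine ⟨minusToPlus hA hker v, funext fun y => ?_⟩
  -- If v represents evaluation at x in H₋, its image has at y the value (e_y, v)₋, the conjugate of
  -- e_y(x).
  rw [plusFun, inner_minusToPlus, ← inner_conj_symm, hv, basisVec_apply, Pi.single_apply]
  by_cases h : y = x
  · simp [h]
  · simp [h, Ne.symm h]

theorem localDualIntensity_nonneg (Λ : Finset E) (x : E) (ξ : Set E) :
    0 ≤ localDualIntensity A hA hker Λ x ξ :=
  Real.sInf_nonneg (by rintro _ ⟨v, _, _, _, rfl⟩; positivity)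

/-- A larger Λ allows more g. Nonemptiness, supplied by e_x ∈ H₊, is essential, since `sInf ∅ = 0`
in ℝ. -/
theorem localDualIntensity_antitone {hA : A.IsPositive} (hH : HypothesisH A hA)
    (hker : LinearMap.ker (A : H0 E →ₗ[ℂ] H0 E) = ⊥) (x : E) (ξ : Set E) :
    Antitone fun Λ : Finset E => localDualIntensity A hA hker Λ x ξ := by
  intro Λ Λ' h
  refine csInf_le_csInf ⟨0, by rintro _ ⟨v, _, _, _, rfl⟩; positivity⟩ ?_ ?_
  · obtain ⟨v, hv⟩ := hH.exists_plusFun_eq_single hker x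
    exact ⟨_, v, 0, Submodule.zero_mem _, by rw [hv, sub_zero], rfl⟩
  · rintro _ ⟨v, g, hg, hv, rfl⟩
    refine ⟨v, g, Submodule.span_mono (Set.image_mono ?_) hg, hv, rfl⟩
    exact Set.sdiff_subset_sdiff_left (Finset.coe_subset.2 h)

theorem tendsto_localDualIntensity {hA : A.IsPositive} (hH : HypothesisH A hA)
    (hker : LinearMap.ker (A : H0 E →ₗ[ℂ] H0 E) = ⊥) (x : E) (ξ : Set E) :
    Tendsto (fun Λ : Finset E => localDualIntensity A hA hker Λ x ξ) atTop
      (𝓝 (dualIntensity A hA hker x ξ)) :=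
  tendsto_nhds_limUnder ⟨_, tendsto_atTop_ciInf (localDualIntensity_antitone hH hker x ξ)
    ⟨0, by rintro _ ⟨Λ, rfl⟩; exact localDualIntensity_nonneg hA hker Λ x ξ⟩⟩

theorem dualIntensity_nonneg {hA : A.IsPositive} (hH : HypothesisH A hA)
    (hker : LinearMap.ker (A : H0 E →ₗ[ℂ] H0 E) = ⊥) (x : E) (ξ : Set E) :
    0 ≤ dualIntensity A hA hker x ξ :=
  ge_of_tendsto' (tendsto_localDualIntensity hH hker x ξ)
    fun Λ => localDualIntensity_nonneg hA hker Λ x ξ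

end Dual

end

section

/-! ### Local functions on the configuration space -/

/-- `f(ξ)` depends only on `ξ ∩ Λ`. -/
def IsLocal (Λ : Finset E) (f : Set E → ℝ) : Prop :=
  ∀ ξ ζ : Set E, ξ ∩ (Λ : Set E) = ζ ∩ (Λ : Set E) → f ξ = f ζ

theorem measurableSet_cylinder (Λ : Finset E) (T : Set E) :
    MeasurableSet {ζ : Set E | ζ ∩ (Λ : Set E) = T ∩ (Λ : Set E)} := by
  classical
  convert measurableSet_superset_disjoint (Λ.filter (· ∈ T)) (Λ.filter (· ∉ T)) using 1
  ext ζ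
  simp only [Set.ext_iff, Set.mem_inter_iff, Set.subset_def, Finset.coe_filter, Set.mem_ofPred_eq,
    Finset.mem_filter, SetLike.mem_coe]
  grind

theorem IsLocal.eq_sum {Λ : Finset E} {f : Set E → ℝ} (hf : IsLocal Λ f) (ξ : Set E) :
    f ξ = ∑ T ∈ Λ.powerset, {ζ : Set E | ζ ∩ (Λ : Set E) = (T : Set E) ∩ (Λ : Set E)}.indicator
      (fun _ => f (T : Set E)) ξ := by
  classical
  have hT : (Λ.filter (· ∈ ξ) : Set E) ∩ (Λ : Set E) = ξ ∩ (Λ : Set E) := by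
    ext y; simp; tauto
  rw [Finset.sum_eq_single (Λ.filter (· ∈ ξ))]
  · rw [Set.indicator_of_mem]
    · exact (hf _ _ hT).symm
    · exact hT.symm
  · intro T hT' hne
    rw [Set.indicator_of_notMem]
    intro h
    refine hne (Finset.ext fun y => ?_)
    have h1 := Set.ext_iff.1 h y
    have h2 := Finset.mem_powerset.1 hT'
    simp only [Set.mem_inter_iff, SetLike.mem_coe] at h1
    rw [Finset.mem_filter]
    constructor
    · exact fun hy => ⟨h2 hy, (h1.2 ⟨hy, h2 hy⟩).1⟩
    · exact fun hy => (h1.1 ⟨hy.2, hy.1⟩).1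
  · intro h
    exact absurd (Finset.mem_powerset.2 (Finset.filter_subset _ _)) h

theorem IsLocal.measurable {Λ : Finset E} {f : Set E → ℝ} (hf : IsLocal Λ f) : Measurable f := by
  rw [funext hf.eq_sum]
  exact Finset.measurable_sum _ fun T _ =>
    measurable_const.indicator (measurableSet_cylinder Λ _)

theorem IsLocal.integral_eq {Λ : Finset E} {f : Set E → ℝ} (hf : IsLocal Λ f)
    (μ : Measure (Set E)) [IsFiniteMeasure μ] :
    ∫ ξ, f ξ ∂μ = ∑ T ∈ Λ.powerset, marginal μ Λ (T : Set E) * f (T : Set E) := by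
  rw [integral_congr_ae (Eventually.of_forall hf.eq_sum), integral_finsetSum]
  · refine Finset.sum_congr rfl fun T _ => ?_
    rw [integral_indicator_const _ (measurableSet_cylinder Λ _)]
    rfl
  · exact fun T _ => (integrable_const _).indicator (measurableSet_cylinder Λ _)

theorem IsLocal.exists_abs_le {Λ : Finset E} {f : Set E → ℝ} (hf : IsLocal Λ f) :
    ∃ C, ∀ ξ, |f ξ| ≤ C := by
  refine ⟨∑ T ∈ Λ.powerset, |f (T : Set E)|, fun ξ => ?_⟩
  rw [hf.eq_sum ξ]
  refine (Finset.abs_sum_le_sum_abs _ _).trans (Finset.sum_le_sum fun T _ => ?_)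
  rw [Set.indicator_apply]
  split_ifs <;> simp

theorem IsLocal.configContinuous {Λ : Finset E} {f : Set E → ℝ} (hf : IsLocal Λ f) :
    ConfigContinuous f := by
  refine continuous_iff_continuousAt.2 fun η => ?_
  have h : ∀ᶠ η' : E → Bool in 𝓝 η, ∀ x ∈ Λ, η' x = η x :=
    (Filter.eventually_all_finset Λ).2 fun x _ =>
      ((continuous_apply x).tendsto η).eventually (p := fun b => b = η x)
        (by rw [nhds_discrete]; exact rfl)
  refine tendsto_const_nhds.congr' ?_
  filter_upwards [h] with η' h'
  refine hf _ _ (Set.ext fun y => ?_)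
  simp only [Set.mem_inter_iff, Set.mem_ofPred_eq, SetLike.mem_coe]
  exact ⟨fun h => ⟨by rw [h' y h.2]; exact h.1, h.2⟩,
    fun h => ⟨by rw [← h' y h.2]; exact h.1, h.2⟩⟩

/-- Oscillations vanish off Λ. This supplies the test functions for the necessity of the balance
equation. -/
theorem IsLocal.isSmooth {Λ : Finset E} {f : Set E → ℝ} (hf : IsLocal Λ f) : IsSmooth f := by
  refine ⟨hf.configContinuous, ?_⟩
  obtain ⟨C, hC⟩ := hf.exists_abs_le
  rw [tsum_eq_sum (s := Λ)]
  · refine ENNReal.sum_lt_top.2 fun x _ => ?_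
    refine lt_of_le_of_lt (iSup_le fun ξ => ENNReal.ofReal_le_ofReal ?_)
      (ENNReal.ofReal_lt_top (r := C + C))
    exact (abs_sub _ _).trans (add_le_add (hC _) (hC _))
  · intro x hx
    simp only [ENNReal.iSup_eq_zero, ENNReal.ofReal_eq_zero]
    intro ξ
    rw [hf (insert x ξ) ξ, sub_self, abs_zero]
    ext y
    simp only [Set.mem_inter_iff, Set.mem_insert_iff, SetLike.mem_coe]
    constructor
    · rintro ⟨rfl | h, h'⟩
      · exact absurd h' hx
      · exact ⟨h, h'⟩
    · exact fun h => ⟨Or.inr h.1, h.2⟩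

/-! ### Functions of class `D` -/

theorem measurable_config {f : Set E → ℝ} [Countable E] (hf : ConfigContinuous f) :
    Measurable f := by
  classical
  have h : Measurable fun ξ : Set E => fun x : E => decide (x ∈ ξ) :=
    measurable_pi_iff.2 fun x =>
      (Measurable.of_discrete (f := fun p : Prop => decide p)).comp (measurable_set_mem x)
  have := (Continuous.measurable hf).comp h
  convert this using 1
  funext ξ
  simp

theorem ConfigContinuous.exists_abs_le {f : Set E → ℝ} (hf : ConfigContinuous f) :
    ∃ C, 0 ≤ C ∧ ∀ ξ, |f ξ| ≤ C := by
  classical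
  obtain ⟨C, hC⟩ := isCompact_univ.exists_bound_of_continuousOn (Continuous.continuousOn hf)
  have h : ∀ ξ, |f ξ| ≤ C := fun ξ => by
    have := hC (fun x => decide (x ∈ ξ)) (Set.mem_univ _)
    simpa using this
  exact ⟨C, (abs_nonneg _).trans (h ∅), h⟩

/-- The oscillation `sup_ξ |f(xξ) - f(ξ)|` at the site `x`. -/
def osc (f : Set E → ℝ) (x : E) : ℝ≥0∞ := ⨆ ξ : Set E, ENNReal.ofReal |f (insert x ξ) - f ξ|

theorem ofReal_abs_insert_sub_le (f : Set E → ℝ) (x : E) (ξ : Set E) :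
    ENNReal.ofReal |f (insert x ξ) - f ξ| ≤ osc f x :=
  le_iSup (fun ξ : Set E => ENNReal.ofReal |f (insert x ξ) - f ξ|) ξ

theorem ofReal_abs_remove_sub_le (f : Set E → ℝ) (x : E) (ξ : Set E) :
    ENNReal.ofReal |f (ξ \ {x}) - f ξ| ≤ osc f x := by
  by_cases hx : x ∈ ξ
  · have := ofReal_abs_insert_sub_le f x (ξ \ {x})
    rwa [Set.insert_sdiff_singleton, Set.insert_eq_of_mem hx, abs_sub_comm] at this
  · simp [Set.sdiff_singleton_eq_self hx]

theorem ofReal_abs_jump_sub_le (f : Set E → ℝ) (x y : E) (ξ : Set E) :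
    ENNReal.ofReal |f (insert y (ξ \ {x})) - f ξ| ≤ osc f x + osc f y := by
  rw [← sub_add_sub_cancel _ (f (ξ \ {x})), add_comm (osc f x)]
  refine (ENNReal.ofReal_le_ofReal (abs_add_le _ _)).trans (ENNReal.ofReal_add_le.trans ?_)
  exact add_le_add (ofReal_abs_insert_sub_le f y _) (ofReal_abs_remove_sub_le f x ξ)

theorem IsSmooth.summable_osc {f : Set E → ℝ} (hf : IsSmooth f) :
    Summable fun x => (osc f x).toReal :=
  ENNReal.summable_toReal hf.2.ne

theorem IsSmooth.osc_ne_top {f : Set E → ℝ} (hf : IsSmooth f) (x : E) : osc f x ≠ ∞ :=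
  ENNReal.ne_top_of_tsum_ne_top hf.2.ne x

/-! ### Insertion of a point -/

theorem measurable_insert (x : E) : Measurable fun ξ : Set E => insert x ξ := by
  refine measurable_set_iff.2 fun y => ?_
  by_cases h : y = x
  · simp [h]
  · simpa [h] using measurable_set_mem y

theorem measurable_remove (x : E) : Measurable fun ξ : Set E => ξ \ {x} := by
  refine measurable_set_iff.2 fun y => ?_
  by_cases h : y = x
  · simp [h]
  · simpa [h] using measurable_set_mem y

theorem insert_remove_self {x : E} {ξ : Set E} (hx : x ∉ ξ) : insert x ξ \ {x} = ξ := by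
  rw [Set.insert_sdiff_of_mem _ (Set.mem_singleton x), Set.sdiff_singleton_eq_self hx]

theorem marginal_congr (μ : Measure (Set E)) (Λ : Finset E) {ξ ζ : Set E}
    (h : ξ ∩ (Λ : Set E) = ζ ∩ (Λ : Set E)) : marginal μ Λ ξ = marginal μ Λ ζ := by
  rw [marginal, marginal, h]

theorem isLocal_comp_insert {Λ : Finset E} {f : Set E → ℝ} (hf : IsLocal Λ f) (x : E) :
    IsLocal Λ fun ξ => f (insert x ξ) := by
  refine fun ξ ζ h => hf _ _ (Set.ext fun y => ?_)
  have := Set.ext_iff.1 h y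
  simp only [Set.mem_inter_iff, Set.mem_insert_iff] at this ⊢
  tauto

theorem isLocal_marginal (μ : Measure (Set E)) (Λ : Finset E) : IsLocal Λ (marginal μ Λ) :=
  fun _ _ h => marginal_congr μ Λ h

theorem isLocal_localPapangelou (μ : Measure (Set E)) (Λ : Finset E) (x : E) :
    IsLocal Λ (localPapangelou μ Λ x) := fun ξ ζ h => by
  have := isLocal_comp_insert (isLocal_marginal μ Λ) x ξ ζ h
  simp only at this
  rw [localPapangelou, localPapangelou, isLocal_marginal μ Λ ξ ζ h, this]

theorem isLocal_localDualIntensity (A : H0 E →L[ℂ] H0 E) (hA : A.IsPositive)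
    (hker : LinearMap.ker (A : H0 E →ₗ[ℂ] H0 E) = ⊥) (Λ : Finset E) (x : E) :
    IsLocal Λ (localDualIntensity A hA hker Λ x) := fun ξ ζ h => by
  have : (Λ : Set E) \ insert x ξ = (Λ : Set E) \ insert x ζ := by
    ext y
    have := Set.ext_iff.1 h y
    simp only [Set.mem_inter_iff, Set.mem_insert_iff, Set.mem_sdiff] at this ⊢
    tauto
  rw [localDualIntensity, localDualIntensity, this]

/-! ### Measurability of the intensities and the Georgii–Nguyen–Zessin equation. -/

variable {A : H0 E →L[ℂ] H0 E} {μ : Measure (Set E)} [IsProbabilityMeasure μ]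

theorem measurable_papangelou [Countable E] (hA : A.IsPositive)
    (hker : LinearMap.ker (A : H0 E →ₗ[ℂ] H0 E) = ⊥) (hμ : IsDPP (dppOperator A) μ) (x : E) :
    Measurable (papangelou μ x) :=
  measurable_of_tendsto_metrizable' atTop
    (fun Λ => (isLocal_localPapangelou μ Λ x).measurable)
    (tendsto_pi_nhds.2 fun ξ => tendsto_localPapangelou_papangelou hA hker hμ x ξ)

theorem measurable_dualIntensity [Countable E] {hA : A.IsPositive} (hH : HypothesisH A hA)
    (hker : LinearMap.ker (A : H0 E →ₗ[ℂ] H0 E) = ⊥) (x : E) :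
    Measurable (dualIntensity A hA hker x) :=
  measurable_of_tendsto_metrizable' atTop
    (fun Λ => (isLocal_localDualIntensity A hA hker Λ x).measurable)
    (tendsto_pi_nhds.2 fun ξ => tendsto_localDualIntensity hH hker x ξ)

open Classical in
/-- The local form of the Georgii–Nguyen–Zessin equation. -/
theorem integral_local_insert (hA : A.IsPositive)
    (hker : LinearMap.ker (A : H0 E →ₗ[ℂ] H0 E) = ⊥) (hμ : IsDPP (dppOperator A) μ)
    {Λ : Finset E} {x : E} (hx : x ∈ Λ) {f : Set E → ℝ} (hf : IsLocal Λ f) :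
    ∫ ξ, (if x ∈ ξ then f ξ else 0) ∂μ =
      ∫ ξ, (if x ∈ ξ then 0 else localPapangelou μ Λ x ξ * f (insert x ξ)) ∂μ := by
  have hmem : ∀ ξ ζ : Set E, ξ ∩ (Λ : Set E) = ζ ∩ (Λ : Set E) → (x ∈ ξ ↔ x ∈ ζ) := by
    intro ξ ζ h
    have := Set.ext_iff.1 h x
    simp only [Set.mem_inter_iff, SetLike.mem_coe, hx, and_true] at this
    exact this
  have h1 : IsLocal Λ fun ξ => if x ∈ ξ then f ξ else 0 := fun ξ ζ h => by
    simp only [hmem ξ ζ h, hf ξ ζ h]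
  have h2 : IsLocal Λ fun ξ => if x ∈ ξ then 0 else localPapangelou μ Λ x ξ * f (insert x ξ) :=
    fun ξ ζ h => by
      simp only [hmem ξ ζ h, isLocal_comp_insert hf x ξ ζ h, isLocal_localPapangelou μ Λ x ξ ζ h]
  rw [h1.integral_eq, h2.integral_eq]
  obtain ⟨Λ', hx', rfl⟩ : ∃ Λ' : Finset E, x ∉ Λ' ∧ insert x Λ' = Λ :=
    ⟨Λ.erase x, Finset.notMem_erase x Λ, Finset.insert_erase hx⟩
  -- Pair each T not containing x with xT; what remains is μ_Λ(xT) = μ_Λ(T) α_Λ(x; T).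
  rw [Finset.sum_powerset_insert hx', Finset.sum_powerset_insert hx', ← Finset.sum_add_distrib,
    ← Finset.sum_add_distrib]
  refine Finset.sum_congr rfl fun T hT => ?_
  have hxT : x ∉ T := fun h => hx' (Finset.mem_powerset.1 hT h)
  simp only [SetLike.mem_coe, hxT, if_false, mul_zero, zero_add, Finset.mem_insert_self, if_true,
    add_zero]
  rw [localPapangelou, Finset.coe_insert x T, ← mul_assoc,
    mul_div_cancel₀ _ (marginal_pos hA hker hμ _ _).ne']

theorem generateFrom_superset :
    (Set.instMeasurableSpace : MeasurableSpace (Set E)) = MeasurableSpace.generateFrom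
      (Set.range fun S : Finset E => {ξ : Set E | (S : Set E) ⊆ ξ}) := by
  refine le_antisymm ?_ (MeasurableSpace.generateFrom_le ?_)
  · have h : @Measurable (Set E) (Set E) (MeasurableSpace.generateFrom
        (Set.range fun S : Finset E => {ξ : Set E | (S : Set E) ⊆ ξ})) _ id := by
      refine (@measurable_set_iff _ _ (MeasurableSpace.generateFrom _) _).2 fun a => ?_
      refine (@measurableSet_setOfPred _ (MeasurableSpace.generateFrom _) _).1 ?_
      refine MeasurableSpace.measurableSet_generateFrom ⟨{a}, ?_⟩
      ext ξ
      simp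
    intro s hs
    exact h hs
  · rintro _ ⟨S, rfl⟩
    exact measurableSet_superset S

theorem isPiSystem_superset :
    IsPiSystem (Set.range fun S : Finset E => {ξ : Set E | (S : Set E) ⊆ ξ}) := by
  classical
  rintro _ ⟨S, rfl⟩ _ ⟨T, rfl⟩ -
  exact ⟨S ∪ T, by ext ξ; simp⟩

/-- These events form a generating π-system, and S = ∅ compares the total masses. -/
theorem measure_ext_superset {ν ρ : Measure (Set E)} [IsFiniteMeasure ν]
    (h : ∀ S : Finset E, ν {ξ | (S : Set E) ⊆ ξ} = ρ {ξ | (S : Set E) ⊆ ξ}) : ν = ρ := by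
  refine ext_of_generate_finite _ generateFrom_superset isPiSystem_superset ?_ ?_
  · rintro _ ⟨S, rfl⟩
    exact h S
  · simpa using h ∅

theorem isLocal_indicator_superset (S : Finset E) {Λ : Finset E} (h : S ⊆ Λ) :
    IsLocal Λ ({ξ : Set E | (S : Set E) ⊆ ξ}.indicator fun _ => 1) := fun ξ ζ hξ => by
  classical
  have : (S : Set E) ⊆ ξ ↔ (S : Set E) ⊆ ζ := by
    have h' : ∀ y ∈ S, (y ∈ ξ ↔ y ∈ ζ) := fun y hy => by
      have := Set.ext_iff.1 hξ y
      simp only [Set.mem_inter_iff, SetLike.mem_coe, h hy, and_true] at this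
      exact this
    exact forall₂_congr h'
  simp [Set.indicator_apply, this]

-- Limit of the local equation: its left side is independent of Λ, and ‖A‖ dominates its right side.
open Classical in
theorem integral_superset_insert [Countable E] (hA : A.IsPositive)
    (hker : LinearMap.ker (A : H0 E →ₗ[ℂ] H0 E) = ⊥) (hμ : IsDPP (dppOperator A) μ) (x : E)
    (S : Finset E) :
    ∫ ξ, (if x ∈ ξ then {ξ : Set E | (S : Set E) ⊆ ξ}.indicator (fun _ => (1 : ℝ)) ξ else 0) ∂μ =
      ∫ ξ, (if x ∈ ξ then 0 else papangelou μ x ξ *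
        {ξ : Set E | (S : Set E) ⊆ ξ}.indicator (fun _ => (1 : ℝ)) (insert x ξ)) ∂μ := by
  set F : Set E → ℝ := {ξ : Set E | (S : Set E) ⊆ ξ}.indicator (fun _ => (1 : ℝ)) with hF
  have hFm : Measurable F := measurable_const.indicator (measurableSet_superset S)
  have hF1 : ∀ ξ, 0 ≤ F ξ ∧ F ξ ≤ 1 := fun ξ => by
    rw [hF, Set.indicator_apply]; split_ifs <;> simp
  have hev : ∀ᶠ Λ : Finset E in atTop, x ∈ Λ ∧ S ⊆ Λ := by
    filter_upwards [eventually_ge_atTop (insert x S)] with Λ h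
    exact ⟨h (Finset.mem_insert_self x S), (Finset.subset_insert x S).trans h⟩
  refine tendsto_nhds_unique (tendsto_const_nhds.congr' ?_)
    (tendsto_integral_filter_of_dominated_convergence (l := (atTop : Filter (Finset E)))
    (F := fun Λ ξ => if x ∈ ξ then 0 else localPapangelou μ Λ x ξ * F (insert x ξ))
    (fun _ => ‖A‖) ?_ ?_ (integrable_const _) ?_)
  · filter_upwards [hev] with Λ h
    exact integral_local_insert hA hker hμ h.1 (isLocal_indicator_superset S h.2)
  · refine Eventually.of_forall fun Λ => Measurable.aestronglyMeasurable ?_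
    exact Measurable.ite (measurableSet_mem x) measurable_const
      ((isLocal_localPapangelou μ Λ x).measurable.mul (hFm.comp (measurable_insert x)))
  · filter_upwards [hev] with Λ h
    refine Eventually.of_forall fun ξ => ?_
    split_ifs with hx
    · simp
    · rw [norm_mul, Real.norm_of_nonneg (hF1 _).1, Real.norm_of_nonneg]
      · have := localPapangelou_le_norm hA hker hμ h.1 hx
        exact (mul_le_of_le_one_right (div_nonneg measureReal_nonneg measureReal_nonneg)
          (hF1 _).2).trans this
      · exact div_nonneg measureReal_nonneg measureReal_nonneg
  · refine Eventually.of_forall fun ξ => ?_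
    split_ifs
    · exact tendsto_const_nhds
    · exact (tendsto_localPapangelou_papangelou hA hker hμ x ξ).mul_const _

theorem papangelou_nonneg (hA : A.IsPositive)
    (hker : LinearMap.ker (A : H0 E →ₗ[ℂ] H0 E) = ⊥) (hμ : IsDPP (dppOperator A) μ)
    (x : E) (ξ : Set E) : 0 ≤ papangelou μ x ξ :=
  ge_of_tendsto' (tendsto_localPapangelou_papangelou hA hker hμ x ξ)
    fun _ => div_nonneg measureReal_nonneg measureReal_nonneg

/-- The measure `μ` on `{x ∈ ξ}` has Papangelou intensity `α(x; ·)`. -/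
theorem restrict_mem_eq_map [Countable E] (hA : A.IsPositive)
    (hker : LinearMap.ker (A : H0 E →ₗ[ℂ] H0 E) = ⊥) (hμ : IsDPP (dppOperator A) μ) (x : E) :
    μ.restrict {ξ | x ∈ ξ} = ((μ.restrict {ξ | x ∉ ξ}).withDensity
      fun ξ => ENNReal.ofReal (papangelou μ x ξ)).map (insert x) := by
  classical
  refine measure_ext_superset fun S => ?_
  have hS := measurableSet_superset S
  have hSx : MeasurableSet (insert x ⁻¹' {ξ : Set E | (S : Set E) ⊆ ξ}) := measurable_insert x hS
  have hm := measurable_papangelou hA hker hμ x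
  rw [Measure.map_apply (measurable_insert x) hS, withDensity_apply _ hSx,
    Measure.restrict_restrict hSx, Measure.restrict_apply hS,
    ← lintegral_indicator (hSx.inter (measurableSet_notMem x)),
    ← ofReal_measureReal, ← integral_indicator_one (hS.inter (measurableSet_mem x))]
  have key := integral_superset_insert hA hker hμ x S
  have e1 : ∫ ξ, ({ξ : Set E | (S : Set E) ⊆ ξ} ∩ {ξ | x ∈ ξ}).indicator (1 : Set E → ℝ) ξ ∂μ =
      ∫ ξ, (if x ∈ ξ then {ξ : Set E | (S : Set E) ⊆ ξ}.indicator (fun _ => (1 : ℝ)) ξ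
        else 0) ∂μ := by
    congr 1
    funext ξ
    by_cases h1 : x ∈ ξ <;> by_cases h2 : (S : Set E) ⊆ ξ <;> simp [h1, h2]
  rw [e1, key, ofReal_integral_eq_lintegral_ofReal]
  · refine lintegral_congr fun ξ => ?_
    by_cases h1 : x ∈ ξ <;> by_cases h2 : (S : Set E) ⊆ insert x ξ <;>
      simp [h1, h2]
  · refine Integrable.of_bound (C := ‖A‖) (Measurable.aestronglyMeasurable ?_)
      (Eventually.of_forall fun ξ => ?_)
    · exact Measurable.ite (measurableSet_mem x) measurable_const
        (hm.mul ((measurable_const.indicator hS).comp (measurable_insert x)))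
    · split_ifs with hx
      · simp
      · have h0 := papangelou_nonneg hA hker hμ x ξ
        have h1 := papangelou_le_norm hA hker hμ hx
        rw [Set.indicator_apply]
        split_ifs
        · simpa [abs_of_nonneg h0] using h1
        · simp
  · refine Eventually.of_forall fun ξ => ?_
    simp only [Pi.zero_apply]
    split_ifs
    · exact le_rfl
    · exact mul_nonneg (papangelou_nonneg hA hker hμ x ξ)
        (Set.indicator_nonneg (fun _ _ => zero_le_one) _)

/-- The Georgii–Nguyen–Zessin equation at a single site. -/
theorem setIntegral_mem_eq [Countable E] (hA : A.IsPositive)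
    (hker : LinearMap.ker (A : H0 E →ₗ[ℂ] H0 E) = ⊥) (hμ : IsDPP (dppOperator A) μ) (x : E)
    {f : Set E → ℝ} (hf : Measurable f) :
    ∫ ξ in {ξ | x ∈ ξ}, f ξ ∂μ =
      ∫ ξ in {ξ | x ∉ ξ}, papangelou μ x ξ * f (insert x ξ) ∂μ := by
  have hm := measurable_papangelou hA hker hμ x
  rw [restrict_mem_eq_map hA hker hμ x,
    integral_map (measurable_insert x).aemeasurable hf.aestronglyMeasurable,
    integral_withDensity_eq_integral_toReal_smul hm.ennreal_ofReal
      (Eventually.of_forall fun _ => ENNReal.ofReal_lt_top)]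
  refine integral_congr_ae (Eventually.of_forall fun ξ => ?_)
  simp [ENNReal.toReal_ofReal (papangelou_nonneg hA hker hμ x ξ)]

end

section

/-! ### Series of bounded functions -/

theorem integrable_of_abs_le {μ : Measure (Set E)} [IsFiniteMeasure μ] {f : Set E → ℝ} {C : ℝ}
    (hf : Measurable f) (h : ∀ ξ, |f ξ| ≤ C) : Integrable f μ :=
  Integrable.of_bound hf.aestronglyMeasurable C (Eventually.of_forall h)

theorem integrable_mul_tsum {ι : Type*} [Countable ι] (μ : Measure (Set E)) [IsFiniteMeasure μ]
    {F : ι → Set E → ℝ} {c : ι → ℝ} {f : Set E → ℝ} {M : ℝ} (hf : Measurable f)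
    (hM0 : 0 ≤ M) (hM : ∀ ξ, |f ξ| ≤ M) (hF : ∀ i, Measurable (F i)) (hc : Summable c)
    (hFc : ∀ i ξ, |F i ξ| ≤ c i) :
    Integrable (fun ξ => f ξ * ∑' i, F i ξ) μ ∧
      HasSum (fun i => ∫ ξ, f ξ * F i ξ ∂μ) (∫ ξ, f ξ * ∑' i, F i ξ ∂μ) := by
  have hm : ∀ i, Measurable fun ξ => f ξ * F i ξ := fun i => hf.mul (hF i)
  have hb : ∀ i ξ, |f ξ * F i ξ| ≤ M * c i := fun i ξ => by
    rw [abs_mul]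
    exact mul_le_mul (hM ξ) (hFc i ξ) (abs_nonneg _) hM0
  have hFint : ∀ i, Integrable (fun ξ => f ξ * F i ξ) μ := fun i =>
    integrable_of_abs_le (hm i) (hb i)
  have hsum : Summable fun i => M * c i := hc.mul_left M
  refine ⟨?_, ?_⟩
  · refine integrable_of_abs_le (C := M * ∑' i, c i) (hf.mul (Measurable.tsum hF)) fun ξ => ?_
    rw [abs_mul]
    have h : ‖∑' i, F i ξ‖ ≤ ∑' i, c i := tsum_of_norm_bounded hc.hasSum fun i => hFc i ξ
    exact mul_le_mul (hM ξ) h (abs_nonneg _) hM0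
  · have := hasSum_integral_of_summable_integral_norm hFint (Summable.of_nonneg_of_le
      (fun i => integral_nonneg fun ξ => norm_nonneg _) (fun i => ?_)
      (hsum.mul_left (μ.real Set.univ)))
    · simpa only [tsum_mul_left] using this
    · refine (integral_mono (hFint i).norm (integrable_const (M * c i)) fun ξ => hb i ξ).trans ?_
      simp

/-! ### Glauber dynamics -/

open Classical in
/-- The contribution of the site `x` to the Glauber pregenerator. -/
def siteTerm (b d : E → Set E → ℝ) (f : Set E → ℝ) (x : E) (ξ : Set E) : ℝ :=
  if x ∈ ξ then d x ξ * (f (ξ \ {x}) - f ξ) else b x ξ * (f (insert x ξ) - f ξ)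

section Glauber

variable {b d : E → Set E → ℝ} {C : ℝ}

theorem abs_mul_le_osc {f : Set E → ℝ} (hf : IsSmooth f) (hC : 0 ≤ C) {r s : ℝ} {x : E}
    (hr : |r| ≤ C) (hs : ENNReal.ofReal |s| ≤ osc f x) : |r * s| ≤ C * (osc f x).toReal := by
  rw [abs_mul]
  exact mul_le_mul hr ((ENNReal.ofReal_le_iff_le_toReal (hf.osc_ne_top x)).1 hs) (abs_nonneg _) hC

theorem abs_siteTerm_le (hC : 0 ≤ C) (hb : ∀ x ξ, |b x ξ| ≤ C) (hd : ∀ x ξ, |d x ξ| ≤ C)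
    {f : Set E → ℝ} (hf : IsSmooth f) (x : E) (ξ : Set E) :
    |siteTerm b d f x ξ| ≤ C * (osc f x).toReal := by
  rw [siteTerm]
  split_ifs
  · exact abs_mul_le_osc hf hC (hd x ξ) (ofReal_abs_remove_sub_le f x ξ)
  · exact abs_mul_le_osc hf hC (hb x ξ) (ofReal_abs_insert_sub_le f x ξ)

theorem measurable_siteTerm [Countable E] (hb : ∀ x, Measurable (b x))
    (hd : ∀ x, Measurable (d x)) {f : Set E → ℝ} (hf : IsSmooth f) (x : E) :
    Measurable (siteTerm b d f x) := by
  have hfm := measurable_config hf.1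
  exact Measurable.ite (measurableSet_mem x)
    ((hd x).mul ((hfm.comp (measurable_remove x)).sub hfm))
    ((hb x).mul ((hfm.comp (measurable_insert x)).sub hfm))

theorem glauberConverges (hC : 0 ≤ C) (hb : ∀ x ξ, |b x ξ| ≤ C) (hd : ∀ x ξ, |d x ξ| ≤ C) :
    GlauberConverges b d := by
  intro f hf ξ
  have hs : Summable fun x => C * (osc f x).toReal := hf.summable_osc.mul_left C
  refine ⟨Summable.of_norm_bounded (hs.subtype ξ) fun x => ?_,
    Summable.of_norm_bounded (hs.subtype ξᶜ) fun x => ?_⟩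
  · exact abs_mul_le_osc hf hC (hd x ξ) (ofReal_abs_remove_sub_le f x ξ)
  · exact abs_mul_le_osc hf hC (hb x ξ) (ofReal_abs_insert_sub_le f x ξ)

theorem glauberGenerator_eq_tsum (h : GlauberConverges b d) {f : Set E → ℝ} (hf : IsSmooth f)
    (ξ : Set E) : glauberGenerator b d f ξ = ∑' x, siteTerm b d f x ξ := by
  obtain ⟨h1, h2⟩ := h f hf ξ
  have e1 : ∀ x : ξ, siteTerm b d f x ξ = d x ξ * (f (ξ \ {(x : E)}) - f ξ) := fun x =>
    if_pos x.2
  have e2 : ∀ x : (ξᶜ : Set E), siteTerm b d f x ξ = b x ξ * (f (insert (x : E) ξ) - f ξ) :=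
    fun x => if_neg x.2
  rw [← Summable.tsum_add_tsum_compl (f := fun x => siteTerm b d f x ξ) (s := ξ)
    (h1.congr fun x => (e1 x).symm) (h2.congr fun x => (e2 x).symm), glauberGenerator]
  simp only [e1, e2]

/-- The function `α` is a Papangelou intensity of `μ`: the Georgii–Nguyen–Zessin equation holds at
each site. -/
def HasPapangelouIntensity (μ : Measure (Set E)) (α : E → Set E → ℝ) : Prop :=
  ∀ (x : E) (f : Set E → ℝ), Measurable f →
    ∫ ξ in {ξ | x ∈ ξ}, f ξ ∂μ = ∫ ξ in {ξ | x ∉ ξ}, α x ξ * f (insert x ξ) ∂μ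

variable {μ : Measure (Set E)} [IsProbabilityMeasure μ] {α : E → Set E → ℝ} {a : ℝ}

/-- GNZ moves the part over x ∈ ξ to x ∉ ξ with weight α. The diagonal products cancel, and deaths
and births leave the same antisymmetric expression with opposite signs. -/
theorem integral_siteTerm_sub [Countable E] (hα : HasPapangelouIntensity μ α)
    (hαm : ∀ x, Measurable (α x)) (hα0 : ∀ x ξ, 0 ≤ α x ξ) (hαa : ∀ x ξ, x ∉ ξ → α x ξ ≤ a)
    (hC : 0 ≤ C) (hb : ∀ x ξ, |b x ξ| ≤ C) (hd : ∀ x ξ, |d x ξ| ≤ C)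
    (hbm : ∀ x, Measurable (b x)) (hdm : ∀ x, Measurable (d x))
    {f g : Set E → ℝ} (hf : IsSmooth f) (hg : IsSmooth g) (x : E) :
    ∫ ξ, f ξ * siteTerm b d g x ξ ∂μ - ∫ ξ, g ξ * siteTerm b d f x ξ ∂μ =
      ∫ ξ in {ξ | x ∉ ξ}, (α x ξ * d x (insert x ξ) - b x ξ) *
        (f (insert x ξ) * g ξ - g (insert x ξ) * f ξ) ∂μ := by
  have hfm := measurable_config hf.1
  have hgm := measurable_config hg.1
  obtain ⟨Mf, hMf0, hMf⟩ := hf.1.exists_abs_le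
  obtain ⟨Mg, hMg0, hMg⟩ := hg.1.exists_abs_le
  have hsf := abs_siteTerm_le hC hb hd hf x
  have hsg := abs_siteTerm_le hC hb hd hg x
  have hm1 : Measurable fun ξ => f ξ * siteTerm b d g x ξ :=
    hfm.mul (measurable_siteTerm hbm hdm hg x)
  have hm2 : Measurable fun ξ => g ξ * siteTerm b d f x ξ :=
    hgm.mul (measurable_siteTerm hbm hdm hf x)
  have hb1 : ∀ ξ, |f ξ * siteTerm b d g x ξ| ≤ Mf * (C * (osc g x).toReal) := fun ξ => by
    rw [abs_mul]
    exact mul_le_mul (hMf ξ) (hsg ξ) (abs_nonneg _) hMf0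
  have hb2 : ∀ ξ, |g ξ * siteTerm b d f x ξ| ≤ Mg * (C * (osc f x).toReal) := fun ξ => by
    rw [abs_mul]
    exact mul_le_mul (hMg ξ) (hsf ξ) (abs_nonneg _) hMg0
  set H : Set E → ℝ := fun ξ => f ξ * siteTerm b d g x ξ - g ξ * siteTerm b d f x ξ with hH
  have hHm : Measurable H := hm1.sub hm2
  obtain ⟨B, hB⟩ : ∃ B, ∀ ξ, |H ξ| ≤ B :=
    ⟨_, fun ξ => (abs_sub _ _).trans (add_le_add (hb1 ξ) (hb2 ξ))⟩
  have hB0 : 0 ≤ B := (abs_nonneg _).trans (hB ∅)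
  have hHi : Integrable H μ := integrable_of_abs_le hHm hB
  rw [← integral_sub (integrable_of_abs_le hm1 hb1) (integrable_of_abs_le hm2 hb2)]
  change ∫ ξ, H ξ ∂μ = _
  have hcompl : {ξ : Set E | x ∈ ξ}ᶜ = {ξ | x ∉ ξ} := rfl
  rw [← integral_add_compl (measurableSet_mem x) hHi, hcompl, hα x H hHm, ← integral_add]
  · refine setIntegral_congr_fun (measurableSet_notMem x) fun ξ hx => ?_
    have hx : x ∉ ξ := hx
    simp only [hH, siteTerm, hx, if_false, Set.mem_insert, if_true, insert_remove_self hx]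
    ring
  · refine Integrable.of_bound (C := a * B)
      ((hαm x).mul (hHm.comp (measurable_insert x))).aestronglyMeasurable ?_
    refine (ae_restrict_iff' (measurableSet_notMem x)).2 (Eventually.of_forall fun ξ hx => ?_)
    rw [norm_mul, Real.norm_of_nonneg (hα0 x ξ)]
    exact mul_le_mul (hαa x ξ hx) (hB _) (norm_nonneg _) ((hα0 x ξ).trans (hαa x ξ hx))
  · exact hHi.integrableOn

theorem glauber_hasSum [Countable E] (hC : 0 ≤ C) (hb : ∀ x ξ, |b x ξ| ≤ C)
    (hd : ∀ x ξ, |d x ξ| ≤ C) (hbm : ∀ x, Measurable (b x)) (hdm : ∀ x, Measurable (d x))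
    {f g : Set E → ℝ} (hf : IsSmooth f) (hg : IsSmooth g) :
    Integrable (fun ξ => f ξ * glauberGenerator b d g ξ) μ ∧
      HasSum (fun x => ∫ ξ, f ξ * siteTerm b d g x ξ ∂μ)
        (∫ ξ, f ξ * glauberGenerator b d g ξ ∂μ) := by
  obtain ⟨M, hM0, hM⟩ := hf.1.exists_abs_le
  simp only [glauberGenerator_eq_tsum (glauberConverges hC hb hd) hg]
  exact integrable_mul_tsum μ (measurable_config hf.1) hM0 hM (measurable_siteTerm hbm hdm hg)
    (hg.summable_osc.mul_left C) (abs_siteTerm_le hC hb hd hg)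

/-- u and v are densities on {x ∉ ξ} of finite measures that agree on a π-system; sets S containing
x give the empty event. -/
theorem ae_eq_of_forall_superset {u v : Set E → ℝ} {B : ℝ} {x : E}
    (hu : Measurable u) (hv : Measurable v) (hu0 : ∀ ξ, 0 ≤ u ξ) (hv0 : ∀ ξ, 0 ≤ v ξ)
    (huB : ∀ ξ, x ∉ ξ → u ξ ≤ B) (hvB : ∀ ξ, x ∉ ξ → v ξ ≤ B)
    (h : ∀ S : Finset E, x ∉ S → ∫ ξ in {ξ | x ∉ ξ}, (u ξ - v ξ) *
      {ξ : Set E | (S : Set E) ⊆ ξ}.indicator (fun _ => 1) ξ ∂μ = 0) :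
    ∀ᵐ ξ ∂μ, x ∉ ξ → u ξ = v ξ := by
  have hbound : ∀ w : Set E → ℝ, Measurable w → (∀ ξ, 0 ≤ w ξ) → (∀ ξ, x ∉ ξ → w ξ ≤ B) →
      Integrable w (μ.restrict {ξ | x ∉ ξ}) := fun w hw hw0 hwB => by
    refine Integrable.of_bound (C := B) hw.aestronglyMeasurable ?_
    refine (ae_restrict_iff' (measurableSet_notMem x)).2 (Eventually.of_forall fun ξ hx => ?_)
    rw [Real.norm_of_nonneg (hw0 ξ)]
    exact hwB ξ hx
  have hui := hbound u hu hu0 huB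
  have hvi := hbound v hv hv0 hvB
  have hfin : ∀ w : Set E → ℝ, (∀ ξ, 0 ≤ w ξ) → Integrable w (μ.restrict {ξ | x ∉ ξ}) →
      ∫⁻ ξ in {ξ | x ∉ ξ}, ENNReal.ofReal (w ξ) ∂μ ≠ ∞ := fun w hw hwi => by
    rw [← ofReal_integral_eq_lintegral_ofReal hwi (Eventually.of_forall hw)]
    exact ENNReal.ofReal_ne_top
  have hmeas : (μ.restrict {ξ | x ∉ ξ}).withDensity (fun ξ => ENNReal.ofReal (u ξ)) =
      (μ.restrict {ξ | x ∉ ξ}).withDensity (fun ξ => ENNReal.ofReal (v ξ)) := by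
    have := isFiniteMeasure_withDensity (hfin u hu0 hui)
    refine measure_ext_superset fun S => ?_
    have hS := measurableSet_superset S
    rw [withDensity_apply _ hS, withDensity_apply _ hS,
      ← ofReal_integral_eq_lintegral_ofReal hui.integrableOn (Eventually.of_forall hu0),
      ← ofReal_integral_eq_lintegral_ofReal hvi.integrableOn (Eventually.of_forall hv0)]
    congr 1
    by_cases hxS : x ∈ S
    · have hempty : {ξ : Set E | (S : Set E) ⊆ ξ} ∩ {ξ | x ∉ ξ} = ∅ := by
        ext ξ
        simp only [Set.mem_inter_iff, Set.mem_ofPred_eq, Set.mem_empty_iff_false, iff_false,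
          not_and, not_not]
        exact fun h => h hxS
      rw [Measure.restrict_restrict hS, hempty]
      simp
    · rw [← sub_eq_zero, ← integral_sub hui.integrableOn hvi.integrableOn, ← h S hxS,
        ← integral_indicator hS]
      refine integral_congr_ae (Eventually.of_forall fun ξ => ?_)
      by_cases hξ : (S : Set E) ⊆ ξ <;> simp [hξ]
  have h2 := (withDensity_eq_iff hu.ennreal_ofReal.aemeasurable hv.ennreal_ofReal.aemeasurable
    (hfin u hu0 hui)).1 hmeas
  filter_upwards [(ae_restrict_iff' (measurableSet_notMem x)).1 h2] with ξ hξ hx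
  exact (ENNReal.ofReal_eq_ofReal_iff (hu0 ξ) (hv0 ξ)).1 (hξ hx)

theorem glauber_detailedBalance_iff [Countable E] (hα : HasPapangelouIntensity μ α)
    (hαm : ∀ x, Measurable (α x)) (hα0 : ∀ x ξ, 0 ≤ α x ξ) (hαa : ∀ x ξ, x ∉ ξ → α x ξ ≤ a)
    (hC : 0 ≤ C) (hb0 : ∀ x ξ, 0 ≤ b x ξ) (hd0 : ∀ x ξ, 0 ≤ d x ξ) (hbC : ∀ x ξ, b x ξ ≤ C)
    (hdC : ∀ x ξ, d x ξ ≤ C) (hbm : ∀ x, Measurable (b x)) (hdm : ∀ x, Measurable (d x)) :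
    DetailedBalance μ (glauberGenerator b d) ↔
      ∀ x, ∀ᵐ ξ ∂μ, x ∉ ξ → α x ξ * d x (insert x ξ) = b x ξ := by
  have hb : ∀ x ξ, |b x ξ| ≤ C := fun x ξ => by rw [abs_of_nonneg (hb0 x ξ)]; exact hbC x ξ
  have hd : ∀ x ξ, |d x ξ| ≤ C := fun x ξ => by rw [abs_of_nonneg (hd0 x ξ)]; exact hdC x ξ
  constructor
  · intro hDB x
    refine ae_eq_of_forall_superset (B := max (a * C) C)
      ((hαm x).mul ((hdm x).comp (measurable_insert x))) (hbm x)
      (fun ξ => mul_nonneg (hα0 x ξ) (hd0 x _)) (hb0 x)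
      (fun ξ hx => le_max_of_le_left (mul_le_mul (hαa x ξ hx) (hdC x _) (hd0 x _)
        ((hα0 x ξ).trans (hαa x ξ hx)))) (fun ξ _ => le_max_of_le_right (hbC x ξ))
      fun S hxS => ?_
    classical
    set g : Set E → ℝ := {ξ : Set E | (S : Set E) ⊆ ξ}.indicator (fun _ => 1) with hg
    -- With f = 1{x ∈ ξ} g, the antisymmetric expression vanishes for every site y ≠ x, and at x it
    -- reduces to g.
    set f : Set E → ℝ :=
      {ξ : Set E | ((insert x S : Finset E) : Set E) ⊆ ξ}.indicator (fun _ => 1) with hf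
    have hfs : IsSmooth f := (isLocal_indicator_superset _ subset_rfl).isSmooth
    have hgs : IsSmooth g := (isLocal_indicator_superset _ subset_rfl).isSmooth
    obtain ⟨-, h1⟩ := glauber_hasSum (μ := μ) hC hb hd hbm hdm hfs hgs
    obtain ⟨-, h2⟩ := glauber_hasSum (μ := μ) hC hb hd hbm hdm hgs hfs
    have h3 := h1.sub h2
    rw [(hDB f g hfs hgs).2.2, integral_congr_ae (Eventually.of_forall fun ξ => mul_comm _ (g ξ)),
      sub_self] at h3
    simp only [integral_siteTerm_sub hα hαm hα0 hαa hC hb hd hbm hdm hfs hgs] at h3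
    have hfg : ∀ ξ, f ξ = if x ∈ ξ then g ξ else 0 := fun ξ => by
      by_cases hx : x ∈ ξ <;> simp [hf, hg, hx, Set.indicator_apply, Set.insert_subset_iff]
    have hgx : ∀ ξ, g (insert x ξ) = g ξ := fun ξ => by
      have : (S : Set E) ⊆ insert x ξ ↔ (S : Set E) ⊆ ξ :=
        Set.subset_insert_iff_of_notMem (by simpa using hxS)
      simp [hg, Set.indicator_apply, this]
    have hgg : ∀ ξ, g ξ * g ξ = g ξ := fun ξ => by
      by_cases h : (S : Set E) ⊆ ξ <;> simp [hg, h]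
    have h4 := h3.unique (hasSum_single x fun y hyx => ?_)
    · rw [h4]
      refine setIntegral_congr_fun (measurableSet_notMem x) fun ξ hx => ?_
      have hx : x ∉ ξ := hx
      simp only [hfg, Set.mem_insert, if_true, hx, if_false, mul_zero, sub_zero, hgx, hgg]
    · refine (integral_congr_ae (Eventually.of_forall fun ξ => ?_)).trans (integral_zero _ _)
      have : (x ∈ insert y ξ) ↔ x ∈ ξ := by simp [Ne.symm hyx]
      simp only [hfg, this]
      split_ifs <;> ring
  · intro h f g hf hg
    obtain ⟨i1, h1⟩ := glauber_hasSum (μ := μ) hC hb hd hbm hdm hf hg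
    obtain ⟨i2, h2⟩ := glauber_hasSum (μ := μ) hC hb hd hbm hdm hg hf
    simp only [mul_comm _ (g _)]
    refine ⟨i1, i2, ?_⟩
    rw [← sub_eq_zero]
    refine (h1.sub h2).unique ?_
    refine hasSum_zero.congr_fun fun x => ?_
    rw [integral_siteTerm_sub hα hαm hα0 hαa hC hb hd hbm hdm hf hg]
    refine (integral_congr_ae ?_).trans (integral_zero _ _)
    refine (ae_restrict_iff' (measurableSet_notMem x)).2 ?_
    filter_upwards [h x] with ξ hξ hx
    rw [hξ hx, sub_self, zero_mul]

end Glauber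

/-! ### Kawasaki dynamics -/

open Classical in
/-- The contribution of jumps from `p.1` to `p.2` to the Kawasaki pregenerator. -/
def pairTerm (c : E → E → Set E → ℝ) (f : Set E → ℝ) (p : E × E) (ξ : Set E) : ℝ :=
  if p.1 ∈ ξ ∧ p.2 ∉ ξ then c p.1 p.2 ξ * (f (insert p.2 (ξ \ {p.1})) - f ξ) else 0

section Kawasaki

variable {c : E → E → Set E → ℝ}

open Classical in
/-- The bound on the jump rates between `x` and `y`, with the value zero on the diagonal. -/
def offDiagBound (c : E → E → Set E → ℝ) (x y : E) : ℝ≥0∞ :=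
  if y = x then 0 else kawasakiPairBound c x y

theorem offDiagBound_comm (c : E → E → Set E → ℝ) (x y : E) :
    offDiagBound c x y = offDiagBound c y x := by
  have h : kawasakiPairBound c x y = kawasakiPairBound c y x := by
    simp only [kawasakiPairBound, max_comm, and_comm]
  by_cases hxy : y = x
  · rw [hxy]
  · rw [offDiagBound, offDiagBound, if_neg hxy, if_neg (Ne.symm hxy), h]

theorem tsum_offDiagBound_le (c : E → E → Set E → ℝ) (x : E) :
    ∑' y, offDiagBound c x y ≤ kawasakiBound c := by
  refine le_trans (le_of_eq ?_)
    (le_iSup (fun x => ∑' y : {y : E // y ≠ x}, kawasakiPairBound c x y) x)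
  refine Eq.trans ?_ (tsum_subtype {y | y ≠ x} (kawasakiPairBound c x)).symm
  refine tsum_congr fun y => ?_
  by_cases h : y = x <;> simp [offDiagBound, h]

theorem ofReal_rate_le {x y : E} {ξ : Set E} (hx : x ∈ ξ) (hy : y ∉ ξ) :
    ENNReal.ofReal (c x y ξ) ≤ offDiagBound c x y := by
  have hne : y ≠ x := fun h => hy (h ▸ hx)
  rw [offDiagBound, if_neg hne, kawasakiPairBound]
  refine le_trans ?_ (le_iSup₂ (f := fun (ζ : Set E) (_ : x ∉ ζ ∧ y ∉ ζ) =>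
    max (ENNReal.ofReal (c x y (insert x ζ))) (ENNReal.ofReal (c y x (insert y ζ))))
    (ξ \ {x}) ⟨by simp, fun h => hy h.1⟩)
  rw [Set.insert_sdiff_singleton, Set.insert_eq_of_mem hx]
  exact le_max_left _ _

theorem offDiagBound_le (c : E → E → Set E → ℝ) (x y : E) :
    offDiagBound c x y ≤ kawasakiBound c :=
  (ENNReal.le_tsum y).trans (tsum_offDiagBound_le c x)

/-- Summing first over the other site costs a factor `kawasakiBound c`; symmetry of the pair bound
reduces the second half to the first. -/
theorem tsum_pair_bound_ne_top (hK : kawasakiBound c < ∞) {f : Set E → ℝ} (hf : IsSmooth f) :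
    ∑' p : E × E, offDiagBound c p.1 p.2 * (osc f p.1 + osc f p.2) ≠ ∞ := by
  have h1 : ∑' p : E × E, offDiagBound c p.1 p.2 * osc f p.1 ≠ ∞ := by
    rw [ENNReal.tsum_prod (f := fun x y => offDiagBound c x y * osc f x)]
    simp only [ENNReal.tsum_mul_right]
    refine ne_top_of_le_ne_top (ENNReal.mul_ne_top hK.ne hf.2.ne)
      ((ENNReal.tsum_le_tsum fun x => mul_le_mul_left (tsum_offDiagBound_le c x) _).trans ?_)
    rw [ENNReal.tsum_mul_left]
    rfl
  have h2 : ∑' p : E × E, offDiagBound c p.1 p.2 * osc f p.2 ≠ ∞ := by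
    rw [← (Equiv.prodComm E E).tsum_eq]
    convert h1 using 4 with p
    · exact offDiagBound_comm c _ _
    · rfl
  simp only [mul_add]
  rw [ENNReal.tsum_add]
  exact ENNReal.add_ne_top.2 ⟨h1, h2⟩

theorem abs_pairTerm_le (hc : ∀ x y ξ, 0 ≤ c x y ξ) (hK : kawasakiBound c < ∞) {f : Set E → ℝ}
    (hf : IsSmooth f) (p : E × E) (ξ : Set E) :
    |pairTerm c f p ξ| ≤ (offDiagBound c p.1 p.2 * (osc f p.1 + osc f p.2)).toReal := by
  refine (ENNReal.ofReal_le_iff_le_toReal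
    (ENNReal.ne_top_of_tsum_ne_top (tsum_pair_bound_ne_top hK hf) p)).1 ?_
  rw [pairTerm]
  split_ifs with h
  · rw [abs_mul, abs_of_nonneg (hc _ _ _), ENNReal.ofReal_mul (hc _ _ _)]
    exact mul_le_mul' (ofReal_rate_le h.1 h.2) (ofReal_abs_jump_sub_le f _ _ ξ)
  · simp

theorem summable_pairTerm (hc : ∀ x y ξ, 0 ≤ c x y ξ) (hK : kawasakiBound c < ∞)
    {f : Set E → ℝ} (hf : IsSmooth f) (ξ : Set E) : Summable fun p => pairTerm c f p ξ :=
  Summable.of_norm_bounded (ENNReal.summable_toReal (tsum_pair_bound_ne_top hK hf))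
    fun p => abs_pairTerm_le hc hK hf p ξ

/-- The inclusion of the pairs (occupied site, empty site) in all pairs of sites. -/
def pairInclusion (ξ : Set E) (p : ξ × (ξᶜ : Set E)) : E × E := (p.1, p.2)

theorem pairInclusion_injective (ξ : Set E) : Function.Injective (pairInclusion ξ) :=
  fun _ _ h => Prod.ext (Subtype.ext (congrArg Prod.fst h)) (Subtype.ext (congrArg Prod.snd h))

theorem pairTerm_pairInclusion (c : E → E → Set E → ℝ) (f : Set E → ℝ) (ξ : Set E)
    (p : ξ × (ξᶜ : Set E)) : pairTerm c f (pairInclusion ξ p) ξ =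
      c p.1 p.2 ξ * (f (insert (p.2 : E) (ξ \ {(p.1 : E)})) - f ξ) :=
  if_pos ⟨p.1.2, p.2.2⟩

theorem kawasakiConverges (hc : ∀ x y ξ, 0 ≤ c x y ξ) (hK : kawasakiBound c < ∞) :
    KawasakiConverges c := fun f hf ξ =>
  ((summable_pairTerm hc hK hf ξ).comp_injective (pairInclusion_injective ξ)).congr
    fun p => pairTerm_pairInclusion c f ξ p

/-- No summability is needed: `pairTerm` vanishes off the range of `pairInclusion ξ`. The index set
no longer depends on ξ, so the series can be integrated termwise. -/
theorem kawasakiGenerator_eq_tsum (c : E → E → Set E → ℝ) (f : Set E → ℝ) (ξ : Set E) :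
    kawasakiGenerator c f ξ = ∑' p, pairTerm c f p ξ := by
  rw [← (pairInclusion_injective ξ).tsum_eq (f := fun p => pairTerm c f p ξ)]
  · exact tsum_congr fun p => (pairTerm_pairInclusion c f ξ p).symm
  · intro p hp
    by_cases h : p.1 ∈ ξ ∧ p.2 ∉ ξ
    · exact ⟨(⟨p.1, h.1⟩, ⟨p.2, h.2⟩), rfl⟩
    · exact absurd (if_neg h) hp

variable {μ : Measure (Set E)} [IsProbabilityMeasure μ] {α : E → Set E → ℝ}

theorem measurable_pairTerm [Countable E] (hcm : ∀ x y, Measurable (c x y)) {f : Set E → ℝ}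
    (hf : IsSmooth f) (p : E × E) : Measurable (pairTerm c f p) := by
  have hfm := measurable_config hf.1
  exact Measurable.ite ((measurableSet_mem p.1).inter (measurableSet_notMem p.2))
    ((hcm _ _).mul ((hfm.comp ((measurable_insert p.2).comp (measurable_remove p.1))).sub hfm))
    measurable_const

theorem kawasaki_hasSum [Countable E] (hc : ∀ x y ξ, 0 ≤ c x y ξ) (hK : kawasakiBound c < ∞)
    (hcm : ∀ x y, Measurable (c x y)) {f g : Set E → ℝ} (hf : IsSmooth f) (hg : IsSmooth g) :
    Integrable (fun ξ => f ξ * kawasakiGenerator c g ξ) μ ∧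
      HasSum (fun p => ∫ ξ, f ξ * pairTerm c g p ξ ∂μ)
        (∫ ξ, f ξ * kawasakiGenerator c g ξ ∂μ) := by
  obtain ⟨M, hM0, hM⟩ := hf.1.exists_abs_le
  simp only [kawasakiGenerator_eq_tsum]
  exact integrable_mul_tsum μ (measurable_config hf.1) hM0 hM (measurable_pairTerm hcm hg)
    (ENNReal.summable_toReal (tsum_pair_bound_ne_top hK hg)) (abs_pairTerm_le hc hK hg)

-- The integrand lives on x ∈ ξ, y ∉ ξ; GNZ at x alone removes the particle, and the diagonal
-- products cancel.
open Classical in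
theorem integral_pairTerm_sub [Countable E] (hα : HasPapangelouIntensity μ α)
    (hc : ∀ x y ξ, 0 ≤ c x y ξ) (hK : kawasakiBound c < ∞) (hcm : ∀ x y, Measurable (c x y))
    {f g : Set E → ℝ} (hf : IsSmooth f) (hg : IsSmooth g) {x y : E} (hxy : x ≠ y) :
    ∫ ξ, f ξ * pairTerm c g (x, y) ξ ∂μ - ∫ ξ, g ξ * pairTerm c f (x, y) ξ ∂μ =
      ∫ ξ, (if x ∉ ξ ∧ y ∉ ξ then α x ξ * c x y (insert x ξ) *
        (f (insert x ξ) * g (insert y ξ) - g (insert x ξ) * f (insert y ξ)) else 0) ∂μ := by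
  have hfm := measurable_config hf.1
  have hgm := measurable_config hg.1
  obtain ⟨Mf, hMf0, hMf⟩ := hf.1.exists_abs_le
  obtain ⟨Mg, hMg0, hMg⟩ := hg.1.exists_abs_le
  have hm1 : Measurable fun ξ => f ξ * pairTerm c g (x, y) ξ :=
    hfm.mul (measurable_pairTerm hcm hg _)
  have hm2 : Measurable fun ξ => g ξ * pairTerm c f (x, y) ξ :=
    hgm.mul (measurable_pairTerm hcm hf _)
  have hi1 : Integrable (fun ξ => f ξ * pairTerm c g (x, y) ξ) μ :=
    integrable_of_abs_le hm1 fun ξ => by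
      rw [abs_mul]
      exact mul_le_mul (hMf ξ) (abs_pairTerm_le hc hK hg _ ξ) (abs_nonneg _) hMf0
  have hi2 : Integrable (fun ξ => g ξ * pairTerm c f (x, y) ξ) μ :=
    integrable_of_abs_le hm2 fun ξ => by
      rw [abs_mul]
      exact mul_le_mul (hMg ξ) (abs_pairTerm_le hc hK hf _ ξ) (abs_nonneg _) hMg0
  rw [← integral_sub hi1 hi2, ← setIntegral_eq_integral_of_forall_compl_eq_zero
    (s := {ξ | x ∈ ξ}), hα x (fun ξ => f ξ * pairTerm c g (x, y) ξ - g ξ * pairTerm c f (x, y) ξ)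
    (hm1.sub hm2)]
  · refine Eq.trans ?_ (setIntegral_eq_integral_of_forall_compl_eq_zero (s := {ξ | x ∉ ξ})
      fun ξ hx => if_neg fun h => hx h.1)
    refine setIntegral_congr_fun (measurableSet_notMem x) fun ξ hx => ?_
    have hx : x ∉ ξ := hx
    by_cases hy : y ∈ ξ
    · simp [pairTerm, hy]
    · simp only [pairTerm, Set.mem_insert, Set.mem_insert_iff, hxy.symm, hy, or_self,
        not_false_eq_true, and_self, if_true, insert_remove_self hx, hx]
      ring
  · intro ξ hx
    have hx : x ∉ ξ := hx
    simp [pairTerm, hx]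

/-- By `hbal` the weight is symmetric in x and y while the bracket in f and g is antisymmetric, so
exchanging the sites shows that the total sum equals its own negative. -/
theorem kawasaki_detailedBalance [Countable E] (hα : HasPapangelouIntensity μ α)
    (hc : ∀ x y ξ, 0 ≤ c x y ξ) (hK : kawasakiBound c < ∞) (hcm : ∀ x y, Measurable (c x y))
    (hbal : ∀ x y ξ, x ≠ y → x ∉ ξ → y ∉ ξ →
      α x ξ * c x y (insert x ξ) = α y ξ * c y x (insert y ξ)) :
    DetailedBalance μ (kawasakiGenerator c) := by
  classical
  intro f g hf hg
  obtain ⟨i1, h1⟩ := kawasaki_hasSum (μ := μ) hc hK hcm hf hg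
  obtain ⟨i2, h2⟩ := kawasaki_hasSum (μ := μ) hc hK hcm hg hf
  simp only [mul_comm _ (g _)]
  refine ⟨i1, i2, ?_⟩
  have h := h1.sub h2
  have hneg : ∀ p : E × E,
      ∫ ξ, f ξ * pairTerm c g p.swap ξ ∂μ - ∫ ξ, g ξ * pairTerm c f p.swap ξ ∂μ =
      -(∫ ξ, f ξ * pairTerm c g p ξ ∂μ - ∫ ξ, g ξ * pairTerm c f p ξ ∂μ) := by
    rintro ⟨x, y⟩
    by_cases hxy : x = y
    · subst hxy
      simp [pairTerm]
    rw [Prod.swap_prod_mk, integral_pairTerm_sub hα hc hK hcm hf hg hxy,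
      integral_pairTerm_sub hα hc hK hcm hf hg (Ne.symm hxy), ← integral_neg]
    refine integral_congr_ae (Eventually.of_forall fun ξ => ?_)
    by_cases hx : x ∈ ξ
    · simp [hx]
    by_cases hy : y ∈ ξ
    · simp [hy]
    simp only [hx, hy, not_false_eq_true, and_self, if_true, hbal x y ξ hxy hx hy]
    ring
  have h' := (Equiv.prodComm E E).hasSum_iff.2 h
  have h'' : HasSum (fun p : E × E =>
      -(∫ ξ, f ξ * pairTerm c g p ξ ∂μ - ∫ ξ, g ξ * pairTerm c f p ξ ∂μ)) _ :=
    h'.congr_fun fun p => (hneg p).symm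
  have := h''.unique h.neg
  linarith

end Kawasaki

end

section

/-! ### The rates -/

theorem div_one_add_le_one {r : ℝ} (hr : 0 ≤ r) : r / (1 + r) ≤ 1 :=
  div_le_one_of_le₀ (by linarith) (by linarith)

theorem birthRate_nonneg {α : E → Set E → ℝ} (hα : ∀ x ξ, 0 ≤ α x ξ) (x : E) (ξ : Set E) :
    0 ≤ birthRate α x ξ := by
  have := hα x ξ
  rw [birthRate]
  split_ifs <;> positivity

theorem birthRate_le_one {α : E → Set E → ℝ} (hα : ∀ x ξ, 0 ≤ α x ξ) (x : E) (ξ : Set E) :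
    birthRate α x ξ ≤ 1 := by
  rw [birthRate]
  split_ifs
  · exact zero_le_one
  · exact div_one_add_le_one (hα x ξ)

theorem measurable_birthRate {α : E → Set E → ℝ} (hα : ∀ x, Measurable (α x)) (x : E) :
    Measurable (birthRate α x) :=
  Measurable.ite (measurableSet_mem x) measurable_const
    ((hα x).div (measurable_const.add (hα x)))

theorem deathRate_nonneg {β : E → Set E → ℝ} (hβ : ∀ x ξ, 0 ≤ β x ξ) (x : E) (ξ : Set E) :
    0 ≤ deathRate β x ξ := by
  have := hβ x (ξ \ {x})
  rw [deathRate]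
  split_ifs <;> positivity

theorem deathRate_le_one {β : E → Set E → ℝ} (hβ : ∀ x ξ, 0 ≤ β x ξ) (x : E) (ξ : Set E) :
    deathRate β x ξ ≤ 1 := by
  rw [deathRate]
  split_ifs
  · exact div_one_add_le_one (hβ x _)
  · exact zero_le_one

theorem measurable_deathRate {β : E → Set E → ℝ} (hβ : ∀ x, Measurable (β x)) (x : E) :
    Measurable (deathRate β x) := by
  have := (hβ x).comp (measurable_remove x)
  exact Measurable.ite (measurableSet_mem x) (this.div (measurable_const.add this))
    measurable_const

theorem deathRate_insert (β : E → Set E → ℝ) {x : E} {ξ : Set E} (hx : x ∉ ξ) :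
    deathRate β x (insert x ξ) = β x ξ / (1 + β x ξ) := by
  rw [deathRate, if_pos (Set.mem_insert x ξ), insert_remove_self hx]

theorem glauberBound_lt_top {b d : E → Set E → ℝ} (hb : ∀ x ξ, b x ξ ≤ 1)
    (hd : ∀ x ξ, d x ξ ≤ 1) : glauberBound b d < ∞ := by
  refine lt_of_le_of_lt (iSup_le fun x => iSup₂_le fun ξ _ => ?_) ENNReal.one_lt_top
  exact max_le (ENNReal.ofReal_le_one.2 (hb x ξ)) (ENNReal.ofReal_le_one.2 (hd x _))

/-- The Glauber rates are in balance exactly if the two intensities are reciprocal. -/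
theorem birth_eq_death_iff {u v : ℝ} (hu : 0 < u) (hv : 0 ≤ v) :
    u * (v / (1 + v)) = u / (1 + u) ↔ u * v = 1 := by
  have h1 : 1 + v ≠ 0 := by positivity
  have h2 : 1 + u ≠ 0 := by positivity
  rw [← mul_div_assoc, div_eq_div_iff h1 h2, mul_assoc, mul_right_inj' hu.ne']
  constructor <;> intro h <;> linarith

section Jump

variable {α : E → Set E → ℝ} {w : E → E → ℝ} {g : ℝ → ℝ → ℝ}

theorem jumpRate_insert {x y : E} {ξ : Set E} (hxy : x ≠ y) (hx : x ∉ ξ) (hy : y ∉ ξ) :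
    jumpRate α w g x y (insert x ξ) = w x y * α y ξ * g (α x ξ) (α y ξ) := by
  rw [jumpRate, insert_remove_self hx, if_pos]
  exact ⟨Set.mem_insert x ξ, fun h => h.elim (fun h => hxy h.symm) hy⟩

theorem jumpRate_nonneg (hα : ∀ x ξ, x ∉ ξ → 0 < α x ξ) (hw : ∀ x y, 0 ≤ w x y)
    (hg : ∀ u v, 0 < u → 0 < v → 0 ≤ g u v) (x y : E) (ξ : Set E) :
    0 ≤ jumpRate α w g x y ξ := by
  rw [jumpRate]
  split_ifs with h
  · have hy : y ∉ ξ \ {x} := fun h' => h.2 h'.1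
    have hx : x ∉ ξ \ {x} := fun h' => h'.2 rfl
    exact mul_nonneg (mul_nonneg (hw x y) (hα y _ hy).le) (hg _ _ (hα x _ hx) (hα y _ hy))
  · exact le_rfl

theorem jumpRate_balance (hα : ∀ x ξ, x ∉ ξ → 0 < α x ξ) (hw : ∀ x y, w x y = w y x)
    (hg : ∀ u v, 0 < u → 0 < v → g u v = g v u) {x y : E} {ξ : Set E} (hxy : x ≠ y)
    (hx : x ∉ ξ) (hy : y ∉ ξ) :
    α x ξ * jumpRate α w g x y (insert x ξ) = α y ξ * jumpRate α w g y x (insert y ξ) := by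
  rw [jumpRate_insert hxy hx hy, jumpRate_insert hxy.symm hy hx, hw y x,
    hg _ _ (hα y ξ hy) (hα x ξ hx)]
  ring

/-- g is controlled only on the open quadrant; positivity of α allows its replacement by the
extension by zero. -/
theorem measurable_jumpRate (hα : ∀ x ξ, x ∉ ξ → 0 < α x ξ) (hαm : ∀ x, Measurable (α x))
    (hg : ContinuousOn (fun p : ℝ × ℝ => g p.1 p.2) (Set.Ioi 0 ×ˢ Set.Ioi 0)) (x y : E) :
    Measurable (jumpRate α w g x y) := by
  classical
  set G : ℝ × ℝ → ℝ := (Set.Ioi 0 ×ˢ Set.Ioi 0 : Set (ℝ × ℝ)).piecewise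
    (fun p : ℝ × ℝ => g p.1 p.2) 0 with hG
  have hGm : Measurable G := hg.measurable_piecewise continuousOn_const
    (measurableSet_Ioi.prod measurableSet_Ioi)
  have hx := (hαm x).comp (measurable_remove x)
  have hy := (hαm y).comp (measurable_remove x)
  have : jumpRate α w g x y = fun ξ => if x ∈ ξ ∧ y ∉ ξ then
      w x y * α y (ξ \ {x}) * G (α x (ξ \ {x}), α y (ξ \ {x})) else 0 := by
    funext ξ
    rw [jumpRate]
    split_ifs with h
    · have hy : y ∉ ξ \ {x} := fun h' => h.2 h'.1
      have hx : x ∉ ξ \ {x} := fun h' => h'.2 rfl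
      rw [hG, Set.piecewise_eq_of_mem]
      exact ⟨hα x _ hx, hα y _ hy⟩
    · rfl
  rw [this]
  exact Measurable.ite ((measurableSet_mem x).inter (measurableSet_notMem y))
    ((measurable_const.mul hy).mul (hGm.comp (hx.prodMk hy))) measurable_const

/-- The intensities stay in [0, a], and the extended g is bounded on the compact square [0, a]². -/
theorem kawasakiBound_jumpRate_lt_top {a : ℝ} (hα : ∀ x ξ, x ∉ ξ → 0 < α x ξ)
    (hαa : ∀ x ξ, x ∉ ξ → α x ξ ≤ a) (hw : ∀ x y, 0 ≤ w x y) (hws : ∀ x y, w x y = w y x)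
    (hg : ContinuousOn (fun p : ℝ × ℝ => g p.1 p.2) (Set.Ici 0 ×ˢ Set.Ici 0))
    (hsum : (⨆ x : E, ∑' y : {y : E // y ≠ x}, ENNReal.ofReal (w x y)) < ∞) :
    kawasakiBound (jumpRate α w g) < ∞ := by
  obtain ⟨G, hG⟩ := (isCompact_Icc.prod isCompact_Icc :
    IsCompact (Set.Icc (0 : ℝ) a ×ˢ Set.Icc (0 : ℝ) a)).exists_bound_of_continuousOn
    (hg.mono (Set.prod_mono Set.Icc_subset_Ici_self Set.Icc_subset_Ici_self))
  have hrate : ∀ x y ξ, x ≠ y → x ∉ ξ → y ∉ ξ →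
      ENNReal.ofReal (jumpRate α w g x y (insert x ξ)) ≤
        ENNReal.ofReal (w x y) * ENNReal.ofReal (a * G) := by
    intro x y ξ hxy hx hy
    rw [jumpRate_insert hxy hx hy, ← ENNReal.ofReal_mul (hw x y), mul_assoc]
    refine ENNReal.ofReal_le_ofReal (mul_le_mul_of_nonneg_left ?_ (hw x y))
    have h1 := hG (α x ξ, α y ξ)
      ⟨⟨(hα x ξ hx).le, hαa x ξ hx⟩, ⟨(hα y ξ hy).le, hαa y ξ hy⟩⟩
    have h2 : g (α x ξ) (α y ξ) ≤ G := (le_abs_self _).trans h1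
    have h3 : 0 ≤ G := (norm_nonneg _).trans h1
    exact (mul_le_mul_of_nonneg_left h2 (hα y ξ hy).le).trans
      (mul_le_mul_of_nonneg_right (hαa y ξ hy) h3)
  refine lt_of_le_of_lt (b := (⨆ x : E, ∑' y : {y : E // y ≠ x}, ENNReal.ofReal (w x y)) *
    ENNReal.ofReal (a * G)) (iSup_le fun x => ?_)
    (ENNReal.mul_lt_top hsum ENNReal.ofReal_lt_top)
  refine (ENNReal.tsum_le_tsum (g := fun y : {y : E // y ≠ x} =>
    ENNReal.ofReal (w x y) * ENNReal.ofReal (a * G)) fun y => ?_).trans ?_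
  · refine iSup₂_le fun ξ h => max_le (hrate x y ξ y.2.symm h.1 h.2) ?_
    rw [hws x y]
    exact hrate y x ξ y.2 h.2 h.1
  · rw [ENNReal.tsum_mul_right]
    gcongr
    exact le_iSup (fun x : E => ∑' y : {y : E // y ≠ x}, ENNReal.ofReal (w x y)) x

theorem exists_jumpRate_le (hK : kawasakiBound (jumpRate α w g) < ∞) :
    ∃ C : ℝ, ∀ x y ξ, jumpRate α w g x y ξ ≤ C := by
  refine ⟨(kawasakiBound (jumpRate α w g)).toReal, fun x y ξ => ?_⟩
  by_cases h : x ∈ ξ ∧ y ∉ ξ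
  · exact (ENNReal.ofReal_le_iff_le_toReal hK.ne).1
      ((ofReal_rate_le h.1 h.2).trans (offDiagBound_le _ x y))
  · rw [jumpRate, if_neg h]
    exact ENNReal.toReal_nonneg

end Jump

end

end

end DPPDynamics

/-! ### Assembly of the theorem. -/

theorem proposition3p3 {E : Type*} [Countable E]
    (A : H0 E →L[ℂ] H0 E) (hA : A.IsPositive)
    (hker : LinearMap.ker (A : H0 E →ₗ[ℂ] H0 E) = ⊥) (hH : HypothesisH A hA)
    (μ : Measure (Set E)) [IsProbabilityMeasure μ] (hμ : IsDPP (dppOperator A) μ)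
    (α β : E → Set E → ℝ) (hα : α = papangelou μ) (hβ : β = fun x ξ => (α x ξ)⁻¹) :
    -- the Papangelou intensities exist, are positive, and `α β = 1`
    (∀ x ξ, x ∉ ξ →
      Tendsto (fun Λ : Finset E => localPapangelou μ Λ x ξ) atTop (𝓝 (α x ξ)) ∧
      0 < α x ξ ∧ α x ξ * β x ξ = 1) ∧
    -- (a) Glauber dynamics
    ((∀ x ξ, 0 ≤ birthRate α x ξ ∧ 0 ≤ deathRate β x ξ) ∧
      glauberBound (birthRate α) (deathRate β) < ∞ ∧
      (∀ x ξ, x ∉ ξ → birthRate α x ξ = α x ξ * deathRate β x (insert x ξ)) ∧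
      GlauberConverges (birthRate α) (deathRate β) ∧
      DetailedBalance μ (glauberGenerator (birthRate α) (deathRate β))) ∧
    -- (a') the same with the dual variational quantity in place of `1 / α`
    ((∀ x ξ, 0 ≤ deathRate (dualIntensity A hA hker) x ξ) ∧
      glauberBound (birthRate α) (deathRate (dualIntensity A hA hker)) < ∞ ∧
      GlauberConverges (birthRate α) (deathRate (dualIntensity A hA hker)) ∧
      (DetailedBalance μ
          (glauberGenerator (birthRate α) (deathRate (dualIntensity A hA hker))) ↔
        ∀ᵐ ξ ∂μ, ∀ x, x ∉ ξ → α x ξ * dualIntensity A hA hker x ξ = 1)) ∧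
    -- (b) Kawasaki dynamics
    (∀ (w : E → E → ℝ) (g : ℝ → ℝ → ℝ),
      (∀ x y, 0 ≤ w x y) → (∀ x y, w x y = w y x) →
      (∀ u v, 0 < u → 0 < v → 0 ≤ g u v) →
      (∀ u v, 0 < u → 0 < v → g u v = g v u) →
      ContinuousOn (fun p : ℝ × ℝ => g p.1 p.2) (Set.Ioi 0 ×ˢ Set.Ioi 0) →
      (∀ x y ξ, 0 ≤ jumpRate α w g x y ξ) ∧
      (∀ x y ξ, x ≠ y → x ∉ ξ → y ∉ ξ →
        α x ξ * jumpRate α w g x y (insert x ξ) = α y ξ * jumpRate α w g y x (insert y ξ)) ∧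
      (ContinuousOn (fun p : ℝ × ℝ => g p.1 p.2) (Set.Ici 0 ×ˢ Set.Ici 0) →
        (⨆ x : E, ∑' y : {y : E // y ≠ x}, ENNReal.ofReal (w x y)) < ∞ →
        kawasakiBound (jumpRate α w g) < ∞) ∧
      (kawasakiBound (jumpRate α w g) < ∞ →
        (∃ C : ℝ, ∀ x y ξ, jumpRate α w g x y ξ ≤ C) ∧
        KawasakiConverges (jumpRate α w g) ∧
        DetailedBalance μ (kawasakiGenerator (jumpRate α w g)))) := by
  have hαlim : ∀ x ξ, Tendsto (fun Λ : Finset E => localPapangelou μ Λ x ξ) atTop (𝓝 (α x ξ)) :=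
    fun x ξ => hα ▸ tendsto_localPapangelou_papangelou hA hker hμ x ξ
  have hpos : ∀ x ξ, x ∉ ξ → 0 < α x ξ := fun x ξ hx => by
    rw [hα, papangelou_eq hA hker hμ hx]
    exact papangelouInf_pos hH x ξ
  have hα0 : ∀ x ξ, 0 ≤ α x ξ := fun x ξ => hα ▸ papangelou_nonneg hA hker hμ x ξ
  have hαa : ∀ x ξ, x ∉ ξ → α x ξ ≤ ‖A‖ := fun x ξ hx => hα ▸ papangelou_le_norm hA hker hμ hx
  have hαm : ∀ x, Measurable (α x) := fun x => hα ▸ measurable_papangelou hA hker hμ x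
  have hαP : HasPapangelouIntensity μ α := fun x f hf => hα ▸ setIntegral_mem_eq hA hker hμ x hf
  have hβ0 : ∀ x ξ, 0 ≤ β x ξ := fun x ξ => hβ ▸ inv_nonneg.2 (hα0 x ξ)
  have hβm : ∀ x, Measurable (β x) := fun x => hβ ▸ (hαm x).inv
  have hαβ : ∀ x ξ, x ∉ ξ → α x ξ * β x ξ = 1 := fun x ξ hx => by
    rw [hβ]
    exact mul_inv_cancel₀ (hpos x ξ hx).ne'
  have hδ0 := dualIntensity_nonneg hH hker
  have hδm := measurable_dualIntensity hH hker
  have hb0 := birthRate_nonneg hα0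
  have hb1 := birthRate_le_one hα0
  have habs : ∀ r : ℝ, 0 ≤ r → r ≤ 1 → |r| ≤ 1 := fun r h0 h1 => by rwa [abs_of_nonneg h0]
  have hbal : ∀ γ : E → Set E → ℝ, (∀ x ξ, 0 ≤ γ x ξ) → ∀ x ξ, x ∉ ξ →
      (α x ξ * deathRate γ x (insert x ξ) = birthRate α x ξ ↔ α x ξ * γ x ξ = 1) := by
    intro γ hγ x ξ hx
    rw [deathRate_insert γ hx, birthRate, if_neg hx]
    exact birth_eq_death_iff (hpos x ξ hx) (hγ x ξ)
  have hDB : ∀ γ : E → Set E → ℝ, (∀ x ξ, 0 ≤ γ x ξ) → (∀ x, Measurable (γ x)) →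
      (DetailedBalance μ (glauberGenerator (birthRate α) (deathRate γ)) ↔
        ∀ᵐ ξ ∂μ, ∀ x, x ∉ ξ → α x ξ * γ x ξ = 1) := by
    intro γ hγ hγm
    -- Countability of E allows a single null set for all sites. The criterion serves both γ = β and
    -- the dual quantity.
    rw [glauber_detailedBalance_iff hαP hαm hα0 hαa zero_le_one hb0 (deathRate_nonneg hγ) hb1
      (deathRate_le_one hγ) (measurable_birthRate hαm) (measurable_deathRate hγm), ← ae_all_iff]
    refine eventually_congr (Eventually.of_forall fun ξ => ?_)
    exact forall₂_congr fun x hx => hbal γ hγ x ξ hx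
  have hconv : ∀ γ : E → Set E → ℝ, (∀ x ξ, 0 ≤ γ x ξ) →
      GlauberConverges (birthRate α) (deathRate γ) := fun γ hγ =>
    glauberConverges zero_le_one (fun x ξ => habs _ (hb0 x ξ) (hb1 x ξ))
      fun x ξ => habs _ (deathRate_nonneg hγ x ξ) (deathRate_le_one hγ x ξ)
  refine ⟨fun x ξ hx => ⟨hαlim x ξ, hpos x ξ hx, hαβ x ξ hx⟩,
    ⟨fun x ξ => ⟨hb0 x ξ, deathRate_nonneg hβ0 x ξ⟩,
      glauberBound_lt_top hb1 (deathRate_le_one hβ0),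
      fun x ξ hx => ((hbal β hβ0 x ξ hx).2 (hαβ x ξ hx)).symm, hconv β hβ0,
      (hDB β hβ0 hβm).2 (Eventually.of_forall fun ξ x hx => hαβ x ξ hx)⟩,
    ⟨deathRate_nonneg hδ0, glauberBound_lt_top hb1 (deathRate_le_one hδ0), hconv _ hδ0,
      hDB _ hδ0 hδm⟩, fun w g hw hws hg hgs hgc => ?_⟩
  have hc := jumpRate_nonneg hpos hw hg
  have hcb : ∀ x y ξ, x ≠ y → x ∉ ξ → y ∉ ξ →
      α x ξ * jumpRate α w g x y (insert x ξ) = α y ξ * jumpRate α w g y x (insert y ξ) :=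
    fun x y ξ hxy hx hy => jumpRate_balance hpos hws hgs hxy hx hy
  refine ⟨hc, hcb, fun hgc' hsum => kawasakiBound_jumpRate_lt_top hpos hαa hw hws hgc' hsum,
    fun hK => ⟨exists_jumpRate_le hK, kawasakiConverges hc hK, ?_⟩⟩
  exact kawasaki_detailedBalance hαP hc hK (measurable_jumpRate hpos hαm hgc) hcb
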